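/- **Setting.** Let $(\alpha_i)_{i\in\mathbb Z}$ be i.i.d. random variables with values in $(0,1)$ on a probability space $(\Omega_1,Q)$, and put $\epsilon_i=\log\frac{1-\alpha_i}{\alpha_i}$. Assume $E_Q[\epsilon_0]=0$, $\mathrm{Var}_Q(\epsilon_0)>0$ and, for some $0<\eta_0<1/2$, $Q[\eta_0\le\alpha_0\le 1-\eta_0]=1$. For a fixed environment $\alpha$, let $(X_k)_{k\ge0}$ be the Markov chain on $\mathbb Z$ that jumps from $i$ to $i+1$ with probability $\alpha_i$ and to $i-1$ with probability $1-\alpha_i$; $E^\alpha_x$ is its expectation when $X_0=x$. Let $T_x=\inf\{k\ge1: X_k=x\}\in\mathbb N\cup\{\infty\}$ and, for $V\subset\mathbb Z$, $\mathcal L(V,T)=\sum_{j\in V}\sum_{1\le i\le T}\mathbf 1_{X_i=j}$. The potential is the function $S$ on $\mathbb Z$ with $S_0=0$ and $S_k-S_{k-1}=\epsilon_k$ for all $k\in\mathbb Z$. **Valleys.** A triple of integers $M'\le m\le M''$ is a *valley* if $S_{M'}=\max_{[M',m]}S$, $S_{M''}=\max_{[m,M'']}S$, $S_m=\min_{[M',M'']}S$,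 and $|m|$ is smallest among the minimizers of $S$ on $[M',M'']$; its *depth* is $\min(S_{M'}-S_m,S_{M''}-S_m)$. A *right refinement* of it is a couple $(m_1,M_1)$ with $m\le M_1<m_1\le M''$ and $S_{M_1}-S_{m_1}=\max_{m\le t'\le t''\le M''}(S_{t'}-S_{t''})$; it cuts the valley into the valleys $\{M',m,M_1\}$ and $\{M_1,m_1,M''\}$. A *left refinement* is, symmetrically, a couple $(m_1,M_1)$ with $M'\le m_1<M_1\le m$ and $S_{M_1}-S_{m_1}=\max_{M'\le t'\le t''\le m}(S_{t''}-S_{t'})$; it gives $\{M',m_1,M_1\}$ and $\{M_1,m,M''\}$. Among several maximizing couples one takes a couple with smallest absolute values, i.e. such that no other maximizing couple is at most as large in both absolute values and strictly smaller in one of them. Let $\log_1=\log$, $\log_{p+1}=\log\circ\log_p$, let $\gamma>0$ and $\Gamma_n=\log n+\gamma\log_2 n$. A valley $\{M',m,M''\}$ is *deep* if $0\in[M',M'']$, its depth is at least $\Gamma_n$, and $S_{M''}-\max_{[m,0]}S\ge\gamma\log_2n$ if $m<0$, $S_{M'}-\max_{[0,m]}S\ge\gamma\log_2n$ if $m>0$.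 It is a *smallest* deep valley if no valley obtained from it by one or several successive refinements is deep. A *basic valley* is a triple $\{M_n',m_n,M_n\}$ such that $m_n$ is the bottom of a smallest deep valley, $M_n'$ is the largest integer $l\le0$, $l<m_n$, with $S_l-S_{m_n}\ge\Gamma_n$ and, if $m_n>0$, $S_l-\max_{[0,m_n]}S\ge\gamma\log_2n$; and $M_n$ is the smallest integer $l\ge0$, $l>m_n$, with $S_l-S_{m_n}\ge\Gamma_n$ and, if $m_n<0$, $S_l-\max_{[m_n,0]}S\ge\gamma\log_2n$. Put $W_n=\{M_n',\dots,M_n\}$ and, for an integer $p\ge2$, $$f_p(n)=\lfloor(\log_2n\,\log_pn)^2\rfloor,\qquad R_p(n)=(\log_{p+1}n)^{1/2}(\log_pn)^{-1/2},$$ $$F_p(n)=\{m_n-f_p(n),\dots,m_n+f_p(n)\},\qquad \bar F_p(n)=W_n\setminus F_p(n).$$ **Statement.** There is a constant $c>0$ (which depends on nothing) such that, for every environment as above and all $\eta_0$, $\gamma>0$ and $p\ge2$, there is $n_0$ such that for all $n>n_0$ the following holds outside an event of $Q$-probability at most $c\,R_p(n)$: a basic valley exists, and every basic valley $\{M_n',m_n,M_n\}$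 satisfies $$E^\alpha_{m_n}\big[\mathcal L(\bar F_p(n),T_{m_n})\big]\le\frac{2}{\eta_0}\,\frac1{f_p(n)+1} \qquad\text{and}\qquad S_k-S_{m_n}\ge2\log|k-m_n|\quad\text{for all }k\in\bar F_p(n).$$ -/

import Mathlib

open MeasureTheory ProbabilityTheory Filter Topology
open scoped ENNReal

namespace Sinai

/-! ### Environment and potential -/

/-- An environment: the probability `e i` of a jump from `i` to `i + 1`, for every site `i`. -/
abbrev Env : Type := ℤ → Set.Ioo (0 : ℝ) 1

/-- `ε_i = log ((1 - α_i) / α_i)`, as a function of the value `α_i`. -/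
noncomputable def logRatio (a : Set.Ioo (0 : ℝ) 1) : ℝ :=
  Real.log ((1 - (a : ℝ)) / (a : ℝ))

/-- The random potential: `S 0 = 0` and `S k - S (k - 1) = ε_k` for every integer `k`. -/
noncomputable def potential (e : Env) (k : ℤ) : ℝ :=
  ∑ i ∈ Finset.Ioc 0 k, logRatio (e i) - ∑ i ∈ Finset.Ioc k 0, logRatio (e i)

theorem potential_zero (e : Env) : potential e 0 = 0 := by
  simp [potential]

theorem potential_sub (e : Env) (k : ℤ) :
    potential e k - potential e (k - 1) = logRatio (e k) := by
  unfold potential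
  rcases lt_or_ge 0 k with hk | hk
  · have h1 : Finset.Ioc k 0 = ∅ := Finset.Ioc_eq_empty (by omega)
    have h2 : Finset.Ioc (k - 1) 0 = ∅ := Finset.Ioc_eq_empty (by omega)
    have h3 : Finset.Ioc 0 k = insert k (Finset.Ioc 0 (k - 1)) := by
      ext i; simp only [Finset.mem_Ioc, Finset.mem_insert]; omega
    rw [h1, h2, h3, Finset.sum_insert (by simp)]
    simp
  · have h1 : Finset.Ioc 0 k = ∅ := Finset.Ioc_eq_empty (by omega)
    have h2 : Finset.Ioc 0 (k - 1) = ∅ := Finset.Ioc_eq_empty (by omega)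
    have h3 : Finset.Ioc (k - 1) 0 = insert k (Finset.Ioc k 0) := by
      ext i; simp only [Finset.mem_Ioc, Finset.mem_insert]; omega
    rw [h1, h2, h3, Finset.sum_insert (by simp)]
    simp

/-! ### The walk in a fixed environment -/

/-- One step from `i`: to `i + 1` with probability `e i`, to `i - 1` with probability `1 - e i`. -/
noncomputable def stepMeasure (e : Env) (i : ℤ) : Measure ℤ :=
  ENNReal.ofReal (e i : ℝ) • Measure.dirac (i + 1)
    + ENNReal.ofReal (1 - (e i : ℝ)) • Measure.dirac (i - 1)

instance (e : Env) (i : ℤ) : IsProbabilityMeasure (stepMeasure e i) := by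
  constructor
  have h0 : (0 : ℝ) ≤ (e i : ℝ) := (e i).2.1.le
  have h1 : (0 : ℝ) ≤ 1 - (e i : ℝ) := sub_nonneg.2 (e i).2.2.le
  simp [stepMeasure, ← ENNReal.ofReal_add h0 h1]

/-- The transition kernel from the history `(X_0, …, X_n)` to `X_{n+1}`; it depends on the history
only through `X_n`. -/
noncomputable def stepKernel (e : Env) (n : ℕ) : Kernel (Finset.Iic n → ℤ) ℤ where
  toFun h := stepMeasure e (h ⟨n, Finset.mem_Iic.2 le_rfl⟩)
  measurable' :=
    (measurable_of_countable (stepMeasure e)).comp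
      (measurable_pi_apply (⟨n, Finset.mem_Iic.2 le_rfl⟩ : Finset.Iic n))

instance (e : Env) (n : ℕ) : IsMarkovKernel (stepKernel e n) :=
  ⟨fun h => inferInstanceAs
    (IsProbabilityMeasure (stepMeasure e (h ⟨n, Finset.mem_Iic.2 le_rfl⟩)))⟩

/-- The law, on the space of trajectories `ℕ → ℤ`, of the walk in the fixed environment `e`
started at `x`. -/
noncomputable def walkLaw (e : Env) (x : ℤ) : Measure (ℕ → ℤ) :=
  Kernel.traj (X := fun _ => ℤ) (stepKernel e) 0 (fun _ => x)

/-- `T_x`, the first time `k ≥ 1` with `X_k = x` (`⊤` if there is none). -/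
noncomputable def hittingTime (x : ℤ) (X : ℕ → ℤ) : ℕ∞ :=
  ⨅ (k : ℕ) (_ : 1 ≤ k ∧ X k = x), (k : ℕ∞)

open Classical in
/-- The local time at `k` in the time interval `[1, T]`. -/
noncomputable def localTime (k : ℤ) (T : ℕ∞) (X : ℕ → ℤ) : ℝ≥0∞ :=
  ∑' i : ℕ, if 1 ≤ i ∧ (i : ℕ∞) ≤ T ∧ X i = k then 1 else 0

/-- The local time in `V ⊆ ℤ` in the time interval `[1, T]`. -/
noncomputable def localTimeSet (V : Set ℤ) (T : ℕ∞) (X : ℕ → ℤ) : ℝ≥0∞ :=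
  ∑' j : V, localTime j T X

/-- The expected local time in `V` during one excursion from `m`: the walk starts at `m` and is
observed up to its first return to `m`. -/
noncomputable def excursionLocalTime (e : Env) (m : ℤ) (V : Set ℤ) : ℝ≥0∞ :=
  ∫⁻ X, localTimeSet V (hittingTime m X) X ∂(walkLaw e m)

/-! ### Valleys -/

/-- A triple `{M', m, M''}`. -/
structure Triple where
  left : ℤ
  bot : ℤ
  right : ℤ

/-- `{M', m, M''}` is a valley of `S`; a bottom `m` has the smallest absolute value among the
minimizers of `S` on `[M', M'']`. -/
structure IsValley (S : ℤ → ℝ) (v : Triple) : Prop where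
  left_le : v.left ≤ v.bot
  le_right : v.bot ≤ v.right
  left_max : ∀ t ∈ Set.Icc v.left v.bot, S t ≤ S v.left
  right_max : ∀ t ∈ Set.Icc v.bot v.right, S t ≤ S v.right
  bot_min : ∀ t ∈ Set.Icc v.left v.right, S v.bot ≤ S t
  bot_abs : ∀ t ∈ Set.Icc v.left v.right, S t = S v.bot → |v.bot| ≤ |t|

/-- The depth of a valley. -/
noncomputable def depth (S : ℤ → ℝ) (v : Triple) : ℝ :=
  min (S v.left - S v.bot) (S v.right - S v.bot)

/-- `(m₁, M₁)` realizes the largest descent of `S` in `[m, M'']`. -/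
def IsMaxDescent (S : ℤ → ℝ) (v : Triple) (m₁ M₁ : ℤ) : Prop :=
  v.bot ≤ M₁ ∧ M₁ < m₁ ∧ m₁ ≤ v.right ∧
    ∀ t' t'' : ℤ, v.bot ≤ t' → t' ≤ t'' → t'' ≤ v.right → S t' - S t'' ≤ S M₁ - S m₁

/-- `(m₁, M₁)` realizes the largest ascent of `S` in `[M', m]`. -/
def IsMaxAscent (S : ℤ → ℝ) (v : Triple) (m₁ M₁ : ℤ) : Prop :=
  v.left ≤ m₁ ∧ m₁ < M₁ ∧ M₁ ≤ v.bot ∧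
    ∀ t' t'' : ℤ, v.left ≤ t' → t' ≤ t'' → t'' ≤ v.bot → S t'' - S t' ≤ S M₁ - S m₁

/-- `(m₁, M₁)` satisfies `P` and has the smallest absolute values: no other couple satisfying `P`
is at least as small in both entries and smaller in one of them. -/
def IsSmallestCouple (P : ℤ → ℤ → Prop) (m₁ M₁ : ℤ) : Prop :=
  P m₁ M₁ ∧ ∀ m₂ M₂, P m₂ M₂ → |m₂| ≤ |m₁| → |M₂| ≤ |M₁| → |m₂| = |m₁| ∧ |M₂| = |M₁|

/-- `(m₁, M₁)` is obtained by a right refinement of `v`. -/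
def IsRightRefinement (S : ℤ → ℝ) (v : Triple) (m₁ M₁ : ℤ) : Prop :=
  IsSmallestCouple (IsMaxDescent S v) m₁ M₁

/-- `(m₁, M₁)` is obtained by a left refinement of `v`. -/
def IsLeftRefinement (S : ℤ → ℝ) (v : Triple) (m₁ M₁ : ℤ) : Prop :=
  IsSmallestCouple (IsMaxAscent S v) m₁ M₁

/-- `w` is one of the valleys into which one refinement cuts the valley `v`. -/
def RefinesTo (S : ℤ → ℝ) (v w : Triple) : Prop :=
  (∃ m₁ M₁, IsRightRefinement S v m₁ M₁ ∧
      (w = ⟨v.left, v.bot, M₁⟩ ∨ w = ⟨M₁, m₁, v.right⟩)) ∨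
  (∃ m₁ M₁, IsLeftRefinement S v m₁ M₁ ∧
      (w = ⟨v.left, m₁, M₁⟩ ∨ w = ⟨M₁, v.bot, v.right⟩))

/-- `v` is a valley that contains `0` and is of depth larger than `Γ`, with margin `δ`. -/
structure IsDeepValley (S : ℤ → ℝ) (Γ δ : ℝ) (v : Triple) : Prop where
  valley : IsValley S v
  zero_mem : (0 : ℤ) ∈ Set.Icc v.left v.right
  depth_ge : Γ ≤ depth S v
  margin_neg : v.bot < 0 → ∀ t ∈ Set.Icc v.bot 0, δ ≤ S v.right - S t
  margin_pos : 0 < v.bot → ∀ t ∈ Set.Icc 0 v.bot, δ ≤ S v.left - S t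

/-- `v` is a smallest such valley: no valley constructed from it by (one or several successive)
refinements has the three properties. -/
def IsSmallestDeepValley (S : ℤ → ℝ) (Γ δ : ℝ) (v : Triple) : Prop :=
  IsDeepValley S Γ δ v ∧
    ∀ w, Relation.TransGen (RefinesTo S) v w → ¬ IsDeepValley S Γ δ w

/-- `{M_n', m_n, M_n}` is a basic valley: `m_n` is the bottom of a smallest deep valley, `M_n'` and
`M_n` are the first sites on the left and on the right of `m_n` where `S` is high enough. -/
structure IsBasicValley (S : ℤ → ℝ) (Γ δ : ℝ) (v : Triple) : Prop where
  bot : ∃ u, IsSmallestDeepValley S Γ δ u ∧ u.bot = v.bot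
  left : IsGreatest {l : ℤ | l ≤ 0 ∧ l < v.bot ∧ Γ ≤ S l - S v.bot ∧
    (0 < v.bot → ∀ k ∈ Set.Icc 0 v.bot, δ ≤ S l - S k)} v.left
  right : IsLeast {l : ℤ | 0 ≤ l ∧ v.bot < l ∧ Γ ≤ S l - S v.bot ∧
    (v.bot < 0 → ∀ k ∈ Set.Icc v.bot 0, δ ≤ S l - S k)} v.right

/-! ### Scales -/

/-- The iterated logarithm: `log_1 = log`, `log_{p+1} = log ∘ log_p`. -/
noncomputable def iterLog (p n : ℕ) : ℝ := Real.log^[p] (n : ℝ)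

/-- `γ log_2 n`. -/
noncomputable def margin (γ : ℝ) (n : ℕ) : ℝ := γ * iterLog 2 n

/-- `Γ_n = log n + γ log_2 n`. -/
noncomputable def depthScale (γ : ℝ) (n : ℕ) : ℝ := Real.log n + γ * iterLog 2 n

/-- `f_p(n) = ⌊(log_2 n · log_p n)²⌋`. -/
noncomputable def fScale (p n : ℕ) : ℕ := ⌊(iterLog 2 n * iterLog p n) ^ 2⌋₊

/-- `R_p(n) = (log_{p+1} n)^{1/2} (log_p n)^{-1/2}`. -/
noncomputable def rate (p n : ℕ) : ℝ :=
  iterLog (p + 1) n ^ (1 / 2 : ℝ) * iterLog p n ^ (-(1 / 2) : ℝ)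

/-- The part of `W_n = {M_n', …, M_n}` outside `F_p(n) = {m_n - f_p(n), …, m_n + f_p(n)}`. -/
def outside (p n : ℕ) (v : Triple) : Set ℤ :=
  Set.Icc v.left v.right \ Set.Icc (v.bot - (fScale p n : ℤ)) (v.bot + (fScale p n : ℤ))

end Sinai

/-!
The potential `S`, read from `0` to the right and from `0` to the left, gives two independent random
walks with bounded centred steps. Outside a few rare events for these two walks everything is
deterministic; the rare events have total probability `O((log_p n)^{-1/2})`, which is `o(R_p(n))`,
so the constant `c = 1` works. Write `Γ = Γ_n`, `δ = γ log_2 n`, `f = f_p(n)`, `L = log_p n`.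

*Local time.* For the reversible measure `π k = exp (-S k) / α k` the expected local time in `k`
during an excursion from `m` is at most `π k / π m`, because truncated local times satisfy the
recursion of which `π / π m` is a solution (`sum_walkLaw_noReturn_le`). So the lower bound
`2 log |k - m|` for `S k - S m` off `F_p(n)` gives the bound for the local time, by summing `1 / j²`
over `j > f`.

*Valleys.* Let `a < 0 < b` be the first sites on the two sides where `S ≥ Γ`. Unless the walk on one
side falls from `Γ - δ` to `0` before it exceeds `Γ`, a valley with ends `a` and `b` is deep, and
this has two consequences. Refinement shortens valleys, so a smallest deep valley exists. Every
smallest deep valley has its bottom in `(a, b)`: if it contains `[a, b]`, refinements never cut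
`[a, b]` as long as the bottom is outside, so they end with a deep valley (`IsFrame.bot_mem`). Hence
basic valleys lie between the first sites where `S ≥ Γ + δ`, that is in `[-N, N]` for a power `N` of
`log n`, and `2 log |k - m| ≤ A` on them, with `A = 10 log_2 n`.

*Separation.* Suppose `S k < S m + A` with `|k - m| > f`, where `m ≥ 0` is the bottom of a basic
valley; then `S m` is the minimum of `S` over the valley, which contains `0`. Slice the levels into
steps of height `A`, and let `-j A` be a level less than `2 A` above `S m`. After the walk on the
right first reaches this level it does not fall much below it until it has climbed to about `Γ`. If
`k ≥ 0`, this takes more than `f` steps, and the walk is near the level after these steps. The `f`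
steps and the climb cost `O(A / √f)` and `O(A / Γ)` (`IsStepLaw.seqLaw_dipClimb_le`). If `k < 0`,
both walks climb, at a cost of `O(A / Γ)` each. The bottom is above `-D` with `D = Γ √L`, except
with probability `O(Γ / D) = O(1 / √L)`, so there are `O(D / A)` levels, and the sum over them is
`O(D / A * A² / (Γ √f)) = O(√L / L)`, as `√f ≈ log_2 n * L`.

*Random walk.* The estimates used are gambler's ruin (`IsStepLaw.seqLaw_climbs_le`), the bound
`O(1 / √N)` for the probability of staying above a level during `N` steps
(`IsStepLaw.seqLaw_stays_le`), both proved by induction over the horizon, and the strong Markov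
property (`seqLaw_strongMarkov_le`).
-/

namespace Sinai

/-! ### Sequences of i.i.d. steps -/

/-- The sequence `y, s 0, s 1, …`. -/
def prepend (y : ℝ) (s : ℕ → ℝ) : ℕ → ℝ
  | 0 => y
  | n + 1 => s n

/-- The sequence `s n, s (n + 1), …`. -/
def shift (n : ℕ) (s : ℕ → ℝ) : ℕ → ℝ := fun i => s (i + n)

/-- The position after `n` steps of the walk with steps `s`, started at `0`. -/
def psum (s : ℕ → ℝ) (n : ℕ) : ℝ := ∑ i ∈ Finset.range n, s i

@[simp] theorem psum_zero (s : ℕ → ℝ) : psum s 0 = 0 := by simp [psum]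

theorem psum_succ (s : ℕ → ℝ) (n : ℕ) : psum s (n + 1) = psum s n + s n :=
  Finset.sum_range_succ _ _

theorem psum_prepend_succ (y : ℝ) (s : ℕ → ℝ) (n : ℕ) :
    psum (prepend y s) (n + 1) = y + psum s n := by
  simp [psum, Finset.sum_range_succ', prepend, add_comm]

theorem psum_shift (s : ℕ → ℝ) (n k : ℕ) :
    psum (shift n s) k = psum s (n + k) - psum s n := by
  simp [psum, shift, Finset.sum_range_add, add_comm _ n]

theorem psum_neg (s : ℕ → ℝ) (n : ℕ) : psum (-s) n = -psum s n := by
  simp [psum]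

theorem psum_congr {s t : ℕ → ℝ} {n : ℕ} (h : ∀ i < n, s i = t i) : psum s n = psum t n :=
  Finset.sum_congr rfl fun i hi => h i (Finset.mem_range.1 hi)

@[fun_prop]
theorem measurable_psum (n : ℕ) : Measurable fun s : ℕ → ℝ => psum s n := by
  unfold psum; fun_prop

@[fun_prop]
theorem measurable_shift (n : ℕ) : Measurable (shift n) := by
  unfold shift; fun_prop

theorem measurable_prepend : Measurable fun p : ℝ × (ℕ → ℝ) => prepend p.1 p.2 := by
  refine measurable_pi_lambda _ fun n => ?_
  cases n with
  | zero => exact measurable_fst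
  | succ n => exact (measurable_pi_apply n).comp measurable_snd

/-- The law of an i.i.d. sequence of steps with law `μ`. -/
noncomputable def seqLaw (μ : Measure ℝ) [IsProbabilityMeasure μ] : Measure (ℕ → ℝ) :=
  Measure.infinitePi fun _ => μ

section SeqLaw

variable (μ : Measure ℝ) [IsProbabilityMeasure μ]

instance : IsProbabilityMeasure (seqLaw μ) := by unfold seqLaw; infer_instance

theorem map_prepend_prod_seqLaw :
    (μ.prod (seqLaw μ)).map (fun p => prepend p.1 p.2) = seqLaw μ := by
  refine Measure.eq_infinitePi _ fun I t ht => ?_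
  -- enlarging the index set to an initial segment makes the box a product of two boxes
  classical
  set N := I.sup id + 1 with hN
  have hI : ∀ i ∈ I, i < N + 1 := fun i hi => by
    have : i ≤ I.sup id := Finset.le_sup (f := id) hi
    omega
  set t' : ℕ → Set ℝ := fun i => if i ∈ I then t i else Set.univ with ht'
  have mt' : ∀ i, MeasurableSet (t' i) := fun i => by
    by_cases hi : i ∈ I <;> simp [ht', hi, ht i]
  have h1 : Set.pi (I : Set ℕ) t = Set.pi (Finset.range (N + 1) : Set ℕ) t' := by
    ext x
    simp only [Set.mem_pi, Finset.mem_coe, Finset.mem_range, ht']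
    constructor
    · intro h i _
      by_cases hi : i ∈ I
      · simpa [hi] using h i hi
      · simp [hi]
    · intro h i hi
      simpa [hi] using h i (hI i hi)
  have h2 : ∏ i ∈ I, μ (t i) = ∏ i ∈ Finset.range (N + 1), μ (t' i) := by
    rw [← Finset.prod_subset (fun i hi => Finset.mem_range.2 (hI i hi)) (f := fun i => μ (t' i))]
    · exact Finset.prod_congr rfl fun i hi => by simp [ht', hi]
    · intro i _ hi
      simp [ht', hi]
  clear_value N
  rw [h1, h2, Measure.map_apply measurable_prepend
    (MeasurableSet.pi (Set.to_countable _) fun i _ => mt' i)]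
  have h3 : (fun p : ℝ × (ℕ → ℝ) => prepend p.1 p.2) ⁻¹'
      Set.pi (Finset.range (N + 1) : Set ℕ) t' =
      t' 0 ×ˢ Set.pi (Finset.range N : Set ℕ) (fun i => t' (i + 1)) := by
    ext ⟨y, s⟩
    simp only [Set.mem_preimage, Set.mem_pi, Finset.mem_coe, Finset.mem_range, Set.mem_prod]
    constructor
    · intro h
      exact ⟨h 0 (by omega), fun i hi => h (i + 1) (by omega)⟩
    · rintro ⟨h0, h⟩ i hi
      cases i with
      | zero => exact h0
      | succ i => exact h i (by omega)
  rw [h3, Measure.prod_prod, seqLaw, Measure.infinitePi_pi _ (fun i _ => mt' (i + 1)),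
    Finset.prod_range_succ', mul_comm]

/-- Conditioning on the first step. -/
theorem seqLaw_eq_lintegral {E : Set (ℕ → ℝ)} (hE : MeasurableSet E) :
    seqLaw μ E = ∫⁻ y, seqLaw μ {s | prepend y s ∈ E} ∂μ := by
  conv_lhs => rw [← map_prepend_prod_seqLaw μ]
  rw [Measure.map_apply measurable_prepend hE, Measure.prod_apply (measurable_prepend hE)]
  rfl

theorem map_neg_seqLaw [IsProbabilityMeasure (μ.map fun x => -x)] :
    (seqLaw μ).map (fun s => -s) = seqLaw (μ.map fun x => -x) := by
  have := Measure.infinitePi_map_pi (μ := fun _ : ℕ => μ) (f := fun _ x => -x)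
    (fun _ => measurable_neg)
  exact this

/-- `C` is an event of the first `n` steps. -/
def DependsOnFirst (n : ℕ) (C : Set (ℕ → ℝ)) : Prop :=
  ∀ s t : ℕ → ℝ, (∀ i < n, s i = t i) → s ∈ C → t ∈ C

theorem seqLaw_inter_shift {n : ℕ} {C G : Set (ℕ → ℝ)} (hC : MeasurableSet C)
    (hCn : DependsOnFirst n C) (hG : MeasurableSet G) :
    seqLaw μ (C ∩ shift n ⁻¹' G) = seqLaw μ C * seqLaw μ G := by
  induction n generalizing C with
  | zero =>
    have h0 : shift 0 ⁻¹' G = G := by ext s; rfl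
    rw [h0]
    rcases C.eq_empty_or_nonempty with rfl | ⟨s, hs⟩
    · simp
    · have : C = Set.univ := Set.eq_univ_of_forall fun t => hCn s t (by simp) hs
      simp [this]
  | succ n ih =>
    rw [seqLaw_eq_lintegral μ (hC.inter (measurable_shift _ hG)), seqLaw_eq_lintegral μ hC,
      ← lintegral_mul_const]
    · refine lintegral_congr fun y => ?_
      have hy : Measurable fun s : ℕ → ℝ => prepend y s :=
        measurable_prepend.comp measurable_prodMk_left
      refine (ih (hy hC) ?_)
      intro s t hst hs
      refine hCn _ _ (fun i hi => ?_) hs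
      cases i with
      | zero => rfl
      | succ i => exact hst i (by omega)
    · exact measurable_measure_prodMk_left (measurable_prepend hC)

/-- The strong Markov property, for a random time that equals `n` on `C n`. -/
theorem seqLaw_strongMarkov_le {C : ℕ → Set (ℕ → ℝ)} {G : Set (ℕ → ℝ)}
    (hC : ∀ n, MeasurableSet (C n)) (hCn : ∀ n, DependsOnFirst n (C n))
    (hd : Pairwise (Function.onFun Disjoint C)) (hG : MeasurableSet G) :
    seqLaw μ (⋃ n, C n ∩ shift n ⁻¹' G) ≤ seqLaw μ (⋃ n, C n) * seqLaw μ G := by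
  rw [measure_iUnion hd hC, ← ENNReal.tsum_mul_right]
  refine (measure_iUnion_le _).trans (ENNReal.tsum_le_tsum fun n => ?_)
  rw [seqLaw_inter_shift μ (hC n) (hCn n) hG]

end SeqLaw

/-! ### Hitting estimates for walks with bounded centred steps -/

/-- `μ` is a centred law on `[-K, K]` with variance `v > 0`. -/
structure IsStepLaw (μ : Measure ℝ) (K v : ℝ) : Prop where
  bound_pos : 0 < K
  bound : ∀ᵐ x ∂μ, |x| ≤ K
  mean : ∫ x, x ∂μ = 0
  var_pos : 0 < v
  var : ∫ x, x ^ 2 ∂μ = v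

theorem IsStepLaw.neg {μ : Measure ℝ} {K v : ℝ} (h : IsStepLaw μ K v) :
    IsStepLaw (μ.map fun x => -x) K v where
  bound_pos := h.bound_pos
  bound := by
    rw [ae_map_iff measurable_neg.aemeasurable (measurableSet_le (by fun_prop) (by fun_prop))]
    simpa using h.bound
  mean := by
    rw [integral_map measurable_neg.aemeasurable (by fun_prop), integral_neg, h.mean, neg_zero]
  var_pos := h.var_pos
  var := by
    rw [integral_map measurable_neg.aemeasurable (by fun_prop)]
    simpa using h.var

section StepLaw

variable {μ : Measure ℝ} [IsProbabilityMeasure μ] {K v : ℝ}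

theorem IsStepLaw.integrable_id (h : IsStepLaw μ K v) : Integrable (fun x => x) μ :=
  Integrable.of_bound (by fun_prop) K (by simpa using h.bound)

theorem IsStepLaw.integrable_sq (h : IsStepLaw μ K v) : Integrable (fun x => x ^ 2) μ := by
  refine Integrable.of_bound (by fun_prop) (K ^ 2) ?_
  filter_upwards [h.bound] with x hx
  rw [Real.norm_eq_abs, abs_pow]
  gcongr

theorem IsStepLaw.integral_quadratic (h : IsStepLaw μ K v) (a b c : ℝ) :
    Integrable (fun x => a + b * x + c * x ^ 2) μ ∧
      ∫ x, (a + b * x + c * x ^ 2) ∂μ = a + c * v := by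
  have h1 : Integrable (fun x => b * x) μ := h.integrable_id.const_mul b
  have h2 : Integrable (fun x => c * x ^ 2) μ := h.integrable_sq.const_mul c
  have h0 : Integrable (fun _ : ℝ => a) μ := integrable_const a
  refine ⟨(h0.add h1).add h2, ?_⟩
  have e1 := integral_add (h0.add h1) h2
  have e2 := integral_add h0 h1
  simp only [Pi.add_apply] at e1 e2
  rw [e1, e2, integral_const_mul, integral_const_mul, h.mean, h.var]
  simp

/-- One step of an induction over the horizon: a bound on the probability of `E` that is a
quadratic function of the first step may be integrated. -/
theorem IsStepLaw.seqLaw_le (h : IsStepLaw μ K v) {E : Set (ℕ → ℝ)} (hE : MeasurableSet E)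
    (a b c : ℝ) (h0 : ∀ y, |y| ≤ K → 0 ≤ a + b * y + c * y ^ 2)
    (hy : ∀ y, |y| ≤ K →
      seqLaw μ {s | prepend y s ∈ E} ≤ ENNReal.ofReal (a + b * y + c * y ^ 2)) :
    seqLaw μ E ≤ ENNReal.ofReal (a + c * v) := by
  obtain ⟨hi, hq⟩ := h.integral_quadratic a b c
  rw [seqLaw_eq_lintegral μ hE, ← hq, ofReal_integral_eq_lintegral_ofReal hi]
  · refine lintegral_mono_ae ?_
    filter_upwards [h.bound] with y hyK using hy y hyK
  · filter_upwards [h.bound] with y hyK using h0 y hyK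

/-- The walk reaches height `e` before it falls below `-a`. -/
def climbs (a e : ℝ) : Set (ℕ → ℝ) :=
  {s | ∃ l, (∀ i ≤ l, -a ≤ psum s i) ∧ e ≤ psum s l}

/-- The walk stays at or above `-a` during the first `N` steps. -/
def stays (a : ℝ) (N : ℕ) : Set (ℕ → ℝ) := {s | ∀ i ≤ N, -a ≤ psum s i}

theorem measurableSet_stays (a : ℝ) (N : ℕ) : MeasurableSet (stays a N) := by
  simp only [stays, Set.ofPred_forall]
  exact .iInter fun i => .iInter fun _ => measurableSet_le (by fun_prop) (by fun_prop)

theorem climbs_eq_iUnion (a e : ℝ) :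
    climbs a e = ⋃ N : ℕ, {s | ∃ l ≤ N, (∀ i ≤ l, -a ≤ psum s i) ∧ e ≤ psum s l} := by
  ext s
  simp only [climbs, Set.mem_ofPred_eq, Set.mem_iUnion]
  exact ⟨fun ⟨l, h⟩ => ⟨l, l, le_rfl, h⟩, fun ⟨_, l, _, h⟩ => ⟨l, h⟩⟩

theorem measurableSet_climbs_horizon (a e : ℝ) (N : ℕ) :
    MeasurableSet {s : ℕ → ℝ | ∃ l ≤ N, (∀ i ≤ l, -a ≤ psum s i) ∧ e ≤ psum s l} := by
  have : {s : ℕ → ℝ | ∃ l ≤ N, (∀ i ≤ l, -a ≤ psum s i) ∧ e ≤ psum s l} =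
      ⋃ l : ℕ, ⋃ _ : l ≤ N, stays a l ∩ {s | e ≤ psum s l} := by
    ext s; simp [stays, and_left_comm]
  rw [this]
  exact .iUnion fun l => .iUnion fun _ =>
    (measurableSet_stays a l).inter (measurableSet_le (by fun_prop) (by fun_prop))

theorem measurableSet_climbs (a e : ℝ) : MeasurableSet (climbs a e) := by
  rw [climbs_eq_iUnion]
  exact .iUnion fun N => measurableSet_climbs_horizon a e N

/-- Gambler's ruin. With `H = a + e`, the linear function `x ↦ (x + K) / H` of the height `x` of the
walk started at `a` is harmonic, at least `1` above `H`, and nonnegative wherever the walk can be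
when it first falls below `0`. -/
theorem IsStepLaw.seqLaw_climbs_le (h : IsStepLaw μ K v) {a e : ℝ} (ha : -K ≤ a)
    (hae : 0 < a + e) :
    seqLaw μ (climbs a e) ≤ ENNReal.ofReal ((a + K) / (a + e)) := by
  have key : ∀ (H : ℝ), 0 < H → ∀ (N : ℕ) (a : ℝ), -K ≤ a →
      seqLaw μ {s | ∃ l ≤ N, (∀ i ≤ l, -a ≤ psum s i) ∧ H - a ≤ psum s l} ≤
        ENNReal.ofReal ((a + K) / H) := by
    intro H hH N
    induction N with
    | zero =>
      intro a ha
      by_cases haH : H ≤ a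
      · refine prob_le_one.trans ?_
        rw [ENNReal.one_le_ofReal, one_le_div hH]
        linarith [h.bound_pos]
      · have : {s : ℕ → ℝ | ∃ l ≤ 0, (∀ i ≤ l, -a ≤ psum s i) ∧ H - a ≤ psum s l} = ∅ := by
          ext s
          simp only [Set.mem_ofPred_eq, Set.mem_empty_iff_false, iff_false]
          rintro ⟨l, hl, -, h2⟩
          obtain rfl : l = 0 := by omega
          rw [psum_zero] at h2
          exact haH (by linarith)
        rw [this, measure_empty]
        exact zero_le
    | succ N ih =>
      intro a ha
      by_cases haH : H ≤ a
      · refine prob_le_one.trans ?_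
        rw [ENNReal.one_le_ofReal, one_le_div hH]
        linarith [h.bound_pos]
      by_cases ha0 : a < 0
      · have : {s : ℕ → ℝ | ∃ l ≤ N + 1, (∀ i ≤ l, -a ≤ psum s i) ∧ H - a ≤ psum s l} = ∅ := by
          ext s
          simp only [Set.mem_ofPred_eq, Set.mem_empty_iff_false, iff_false]
          rintro ⟨l, -, h1, -⟩
          have := h1 0 (by omega)
          rw [psum_zero] at this
          linarith
        rw [this, measure_empty]
        exact zero_le
      · have hg : ∀ y : ℝ, (a + K) / H + 1 / H * y + 0 * y ^ 2 = (a + y + K) / H := fun y => by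
          field_simp; ring
        have := h.seqLaw_le (measurableSet_climbs_horizon a (H - a) (N + 1)) ((a + K) / H) (1 / H) 0
          (fun y hy => by
            rw [hg]
            have := abs_le.1 hy
            exact div_nonneg (by linarith) hH.le)
          (fun y hy => by
            rw [hg]
            have hy' := abs_le.1 hy
            refine le_trans (measure_mono ?_) (ih (a + y) (by linarith))
            rintro s ⟨l, hl, h1, h2⟩
            cases l with
            | zero => rw [psum_zero] at h2; exact absurd h2 (by linarith)
            | succ l =>
              refine ⟨l, by omega, fun i hi => ?_, ?_⟩
              · have := h1 (i + 1) (by omega)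
                rw [psum_prepend_succ] at this
                linarith
              · rw [psum_prepend_succ] at h2
                linarith)
        simpa using this
  rw [climbs_eq_iUnion, Monotone.measure_iUnion]
  · refine iSup_le fun N => ?_
    have := key (a + e) hae N a ha
    simpa using this
  · intro N N' hN s ⟨l, hl, hs⟩
    exact ⟨l, hl.trans hN, hs⟩

/-- The walk stays in `[-a, H - a)` during the first `N` steps. -/
def staysBelow (a H : ℝ) (N : ℕ) : Set (ℕ → ℝ) :=
  {s | ∀ i ≤ N, -a ≤ psum s i ∧ psum s i < H - a}

theorem measurableSet_staysBelow (a H : ℝ) (N : ℕ) : MeasurableSet (staysBelow a H N) := by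
  simp only [staysBelow, Set.ofPred_forall, Set.ofPred_and]
  exact .iInter fun i => .iInter fun _ => (measurableSet_le (by fun_prop) (by fun_prop)).inter
    (measurableSet_lt (by fun_prop) (by fun_prop))

/-- The walk leaves an interval in a time of the order of the square of its length: the function
`w a = (a + K) (H + K - a) / v` satisfies `E w (a + ξ) = w a - 1`. -/
theorem IsStepLaw.seqLaw_staysBelow_le (h : IsStepLaw μ K v) {H : ℝ} (N : ℕ) {a : ℝ}
    (ha : -K ≤ a) (haH : a ≤ H + K) :
    seqLaw μ (staysBelow a H N) ≤
      ENNReal.ofReal ((a + K) * (H + K - a) / v / (N + 1)) := by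
  have hv := h.var_pos
  have empty : ∀ (N : ℕ) (a : ℝ), ¬ (0 ≤ a ∧ a < H) → staysBelow a H N = ∅ := by
    intro N a hna
    ext s
    simp only [staysBelow, Set.mem_ofPred_eq, Set.mem_empty_iff_false, iff_false]
    intro hs
    have := hs 0 (by omega)
    rw [psum_zero] at this
    exact hna ⟨by linarith, by linarith⟩
  induction N generalizing a with
  | zero =>
    by_cases hb : 0 ≤ a ∧ a < H
    · obtain ⟨b1, b2⟩ := hb
      have hvK : v ≤ K ^ 2 := by
        rw [← h.var]
        have : ∫ x, x ^ 2 ∂μ ≤ ∫ _, K ^ 2 ∂μ := by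
          refine integral_mono_ae h.integrable_sq (integrable_const _) ?_
          filter_upwards [h.bound] with x hx
          exact sq_le_sq' (abs_le.1 hx).1 (abs_le.1 hx).2
        simpa using this
      refine prob_le_one.trans ?_
      rw [ENNReal.one_le_ofReal]
      have hK := h.bound_pos
      have : K ^ 2 ≤ (a + K) * (H + K - a) := by nlinarith
      simp only [CharP.cast_eq_zero, zero_add, div_one]
      rw [one_le_div hv]
      linarith
    · simp [empty 0 a hb]
  | succ N ih =>
    by_cases hb : 0 ≤ a ∧ a < H
    · obtain ⟨b1, b2⟩ := hb
      have hN : (0 : ℝ) < N + 1 := by positivity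
      have hg : ∀ y : ℝ, (a + K) * (H + K - a) / v / (N + 1) + (H - 2 * a) / v / (N + 1) * y
          + (-1 / v / (N + 1)) * y ^ 2
          = (a + y + K) * (H + K - (a + y)) / v / (N + 1) := fun y => by
        field_simp; ring
      have step := h.seqLaw_le (measurableSet_staysBelow a H (N + 1))
        ((a + K) * (H + K - a) / v / (N + 1)) ((H - 2 * a) / v / (N + 1)) (-1 / v / (N + 1))
        (fun y hy => by
          rw [hg]
          have := abs_le.1 hy
          exact div_nonneg (div_nonneg (mul_nonneg (by linarith) (by linarith)) hv.le) hN.le)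
        (fun y hy => by
          rw [hg]
          have hy' := abs_le.1 hy
          refine le_trans (measure_mono ?_) (ih (a := a + y) (by linarith) (by linarith))
          intro s hs i hi
          have := hs (i + 1) (by omega)
          rw [psum_prepend_succ] at this
          constructor <;> linarith)
      -- `(N + 1) q ≤ w - 1` and `q ≤ 1` give `(N + 2) q ≤ w`
      set q := seqLaw μ (staysBelow a H (N + 1)) with hq
      have hq1 : q ≤ 1 := prob_le_one
      have hqt : q ≠ ⊤ := ne_top_of_le_ne_top ENNReal.one_ne_top hq1
      have e : (a + K) * (H + K - a) / v / (N + 1) + -1 / v / (N + 1) * v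
          = ((a + K) * (H + K - a) / v - 1) / (N + 1) := by field_simp; ring
      rw [e] at step
      have hq1' : q.toReal ≤ 1 := by
        simpa using ENNReal.toReal_mono ENNReal.one_ne_top hq1
      rcases le_or_gt 0 (((a + K) * (H + K - a) / v - 1) / (N + 1)) with hpos | hneg
      · have s1 : q.toReal ≤ ((a + K) * (H + K - a) / v - 1) / (N + 1) :=
          ENNReal.toReal_le_of_le_ofReal hpos step
        rw [le_div_iff₀ hN] at s1
        rw [← ENNReal.ofReal_toReal hqt]
        refine ENNReal.ofReal_le_ofReal ?_
        rw [le_div_iff₀ (by positivity)]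
        push_cast
        linarith
      · rw [ENNReal.ofReal_of_nonpos hneg.le] at step
        exact step.trans bot_le
    · simp [empty (N + 1) a hb]

/-- The walk stays above `-a` during `N` steps with probability of order `(a + K) / √N`: it leaves
`[-a, √N)` in this time, and rarely at the upper end. -/
theorem IsStepLaw.seqLaw_stays_le (h : IsStepLaw μ K v) (N : ℕ) {a : ℝ} (ha : -K ≤ a) :
    seqLaw μ (stays a N) ≤
      ENNReal.ofReal ((1 + (1 + 2 * K) / v) * (a + K) / √(N + 1)) := by
  have hv := h.var_pos
  have hK := h.bound_pos
  set H := √((N : ℝ) + 1) with hH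
  have hH2 : H ^ 2 = N + 1 := Real.sq_sqrt (by positivity)
  have hH1 : 1 ≤ H := Real.one_le_sqrt.2 (by have : (0 : ℝ) ≤ N := by positivity
                                             linarith)
  have hH0 : 0 < H := by linarith
  have hc : 0 ≤ (1 + 2 * K) / v := by positivity
  by_cases haH : a ≤ H + K
  · have hsub : stays a N ⊆ climbs a (H - a) ∪ staysBelow a H N := by
      intro s hs
      by_cases hb : ∀ i ≤ N, psum s i < H - a
      · exact Or.inr fun i hi => ⟨hs i hi, hb i hi⟩
      · push Not at hb
        obtain ⟨l, hl, hl2⟩ := hb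
        exact Or.inl ⟨l, fun i hi => hs i (hi.trans hl), hl2⟩
    refine (measure_mono hsub).trans ((measure_union_le _ _).trans ?_)
    refine (add_le_add (h.seqLaw_climbs_le ha (by linarith))
      (h.seqLaw_staysBelow_le N ha haH)).trans ?_
    rw [← ENNReal.ofReal_add (div_nonneg (by linarith) (by linarith))
      (div_nonneg (div_nonneg (mul_nonneg (by linarith) (by linarith)) hv.le) (by positivity))]
    refine ENNReal.ofReal_le_ofReal ?_
    rw [← hH2, show a + (H - a) = H by ring]
    have e1 : (a + K) * (H + K - a) / v / H ^ 2 ≤ (1 + 2 * K) / v * (a + K) / H := by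
      rw [div_div, div_mul_eq_mul_div, div_div, div_le_div_iff₀ (by positivity) (by positivity)]
      have : (H + K - a) ≤ (1 + 2 * K) * H := by nlinarith
      have h2 : (a + K) * (H + K - a) ≤ (a + K) * ((1 + 2 * K) * H) :=
        mul_le_mul_of_nonneg_left this (by linarith)
      have h3 : 0 ≤ v * H := by positivity
      nlinarith [mul_le_mul_of_nonneg_right h2 h3]
    calc (a + K) / H + (a + K) * (H + K - a) / v / H ^ 2
        ≤ (a + K) / H + (1 + 2 * K) / v * (a + K) / H := by linarith
      _ = _ := by ring
  · refine prob_le_one.trans ?_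
    rw [ENNReal.one_le_ofReal, one_le_div hH0]
    push Not at haH
    nlinarith [mul_nonneg hc (by linarith : 0 ≤ a + K)]

/-! ### Composite events -/

/-- The walk, staying above `-a`, is at or below `c` at a time `k ≥ f`, and reaches `e` later. -/
def dipClimb (f : ℕ) (a c e : ℝ) : Set (ℕ → ℝ) :=
  {s | ∃ k l, f ≤ k ∧ k ≤ l ∧ (∀ i ≤ l, -a ≤ psum s i) ∧ psum s k ≤ c ∧ e ≤ psum s l}

/-- At the first time the walk is at or below `x`, its future steps are in `G`. -/
def afterHit (x : ℝ) (G : Set (ℕ → ℝ)) : Set (ℕ → ℝ) :=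
  {s | ∃ n, (psum s n ≤ x ∧ ∀ i < n, x < psum s i) ∧ shift n s ∈ G}

theorem afterHit_eq (x : ℝ) (G : Set (ℕ → ℝ)) :
    afterHit x G = ⋃ n, {s | psum s n ≤ x ∧ ∀ i < n, x < psum s i} ∩ shift n ⁻¹' G := by
  ext s; simp [afterHit]

theorem measurableSet_firstHit (f : ℕ) (x : ℝ) (n : ℕ) :
    MeasurableSet {s : ℕ → ℝ | psum s n ≤ x ∧ ∀ i, f ≤ i → i < n → x < psum s i} := by
  simp only [Set.ofPred_and, Set.ofPred_forall]
  exact (measurableSet_le (by fun_prop) (by fun_prop)).inter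
    (.iInter fun i => .iInter fun _ => .iInter fun _ =>
      measurableSet_lt (by fun_prop) (by fun_prop))

theorem measurableSet_afterHit (x : ℝ) {G : Set (ℕ → ℝ)} (hG : MeasurableSet G) :
    MeasurableSet (afterHit x G) := by
  rw [afterHit_eq]
  refine .iUnion fun n => MeasurableSet.inter ?_ (measurable_shift n hG)
  simpa using measurableSet_firstHit 0 x n

theorem seqLaw_afterHit_le (x : ℝ) {G : Set (ℕ → ℝ)} (hG : MeasurableSet G) :
    seqLaw μ (afterHit x G) ≤ seqLaw μ G := by
  rw [afterHit_eq]
  refine (seqLaw_strongMarkov_le μ (fun n => by simpa using measurableSet_firstHit 0 x n)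
    ?_ ?_ hG).trans (mul_le_of_le_one_left' prob_le_one)
  · rintro n s t hst ⟨h1, h2⟩
    refine ⟨?_, fun i hi => ?_⟩
    · rwa [← psum_congr hst]
    · rw [← psum_congr fun j hj => hst j (hj.trans hi)]
      exact h2 i hi
  · intro n m hnm
    refine Set.disjoint_left.2 fun s hn hm => ?_
    rcases lt_or_gt_of_ne hnm with hlt | hlt
    · exact absurd hn.1 (not_le.2 (hm.2 n hlt))
    · exact absurd hm.1 (not_le.2 (hn.2 m hlt))

theorem IsStepLaw.seqLaw_dipClimb_le (h : IsStepLaw μ K v) (f : ℕ) {a c e : ℝ} (ha : -K ≤ a)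
    (hac : -K ≤ a + c) (hae : 0 < a + e) :
    seqLaw μ (dipClimb f a c e) ≤
      ENNReal.ofReal ((1 + (1 + 2 * K) / v) * (a + K) / √(f + 1)) *
        ENNReal.ofReal ((a + c + K) / (a + e)) := by
  set C : ℕ → Set (ℕ → ℝ) := fun k =>
    {s | f ≤ k} ∩ stays a f ∩ {s | psum s k ≤ c ∧ ∀ i, f ≤ i → i < k → c < psum s i} with hC
  have hsub : dipClimb f a c e ⊆ ⋃ k, C k ∩ shift k ⁻¹' climbs (a + c) (e - c) := by
    rintro s ⟨k, l, hfk, hkl, hs, hk, hl⟩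
    classical
    have hex : ∃ k, f ≤ k ∧ psum s k ≤ c := ⟨k, hfk, hk⟩
    obtain ⟨h1, h2⟩ := Nat.find_spec hex
    have h3 : Nat.find hex ≤ k := Nat.find_min' hex ⟨hfk, hk⟩
    refine Set.mem_iUnion.2 ⟨Nat.find hex, ⟨⟨h1, fun i hi => hs i (by omega)⟩, h2,
      fun i hi1 hi2 => ?_⟩, l - Nat.find hex, fun i hi => ?_, ?_⟩
    · by_contra hcon
      exact Nat.find_min hex hi2 ⟨hi1, not_lt.1 hcon⟩
    · rw [psum_shift]
      have := hs (Nat.find hex + i) (by omega)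
      linarith
    · rw [psum_shift, show Nat.find hex + (l - Nat.find hex) = l by omega]
      linarith
  refine (measure_mono hsub).trans ((seqLaw_strongMarkov_le μ (fun k => ?_) ?_ ?_
    (measurableSet_climbs _ _)).trans (mul_le_mul' ?_ ?_))
  · exact ((MeasurableSet.const _).inter (measurableSet_stays a f)).inter
      (measurableSet_firstHit f c k)
  · rintro k s t hst ⟨⟨h0, h1⟩, h2, h3⟩
    refine ⟨⟨h0, fun i hi => ?_⟩, ?_, fun i hi1 hi2 => ?_⟩
    · rw [← psum_congr fun j hj => hst j (by have : f ≤ k := h0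
                                             omega)]
      exact h1 i hi
    · rwa [← psum_congr hst]
    · rw [← psum_congr fun j hj => hst j (hj.trans hi2)]
      exact h3 i hi1 hi2
  · intro n m hnm
    refine Set.disjoint_left.2 fun s hn hm => ?_
    rcases lt_or_gt_of_ne hnm with hlt | hlt
    · exact absurd hn.2.1 (not_le.2 (hm.2.2 n hn.1.1 hlt))
    · exact absurd hm.2.1 (not_le.2 (hn.2.2 m hm.1.1 hlt))
  · refine (measure_mono ?_).trans (h.seqLaw_stays_le f ha)
    exact Set.iUnion_subset fun k s hs => hs.1.2
  · have := h.seqLaw_climbs_le (a := a + c) (e := e - c) hac (by linarith)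
    rwa [show a + c + (e - c) = a + e by ring] at this

theorem measurableSet_dipClimb (f : ℕ) (a c e : ℝ) : MeasurableSet (dipClimb f a c e) := by
  have : dipClimb f a c e = ⋃ k : ℕ, ⋃ l : ℕ, ⋃ _ : f ≤ k, ⋃ _ : k ≤ l,
      stays a l ∩ ({s | psum s k ≤ c} ∩ {s | e ≤ psum s l}) := by
    ext s
    simp only [dipClimb, stays, Set.mem_ofPred_eq, Set.mem_iUnion, Set.mem_inter_iff]
    exact exists_congr fun k => exists_congr fun l => by tauto
  rw [this]
  exact .iUnion fun k => .iUnion fun l => .iUnion fun _ => .iUnion fun _ =>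
    (measurableSet_stays a l).inter ((measurableSet_le (by fun_prop) (by fun_prop)).inter
      (measurableSet_le (by fun_prop) (by fun_prop)))

end StepLaw

/-! ### Refinements of valleys -/

theorem exists_bottom (S : ℤ → ℝ) {l r : ℤ} (h : l ≤ r) :
    ∃ m ∈ Set.Icc l r, (∀ t ∈ Set.Icc l r, S m ≤ S t) ∧
      ∀ t ∈ Set.Icc l r, S t = S m → |m| ≤ |t| := by
  obtain ⟨m₀, hm₀, h₀⟩ := Finset.exists_min_image (Finset.Icc l r) S ⟨l, by simp [h]⟩
  obtain ⟨m, hm, h₁⟩ := Finset.exists_min_image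
    ((Finset.Icc l r).filter fun t => S t = S m₀) (fun t => |t|)
    ⟨m₀, by simp [Finset.mem_Icc.1 hm₀]⟩
  simp only [Finset.mem_filter, Finset.mem_Icc] at hm h₁ h₀
  refine ⟨m, hm.1, fun t ht => ?_, fun t ht hS => h₁ t ⟨ht, hS.trans hm.2⟩⟩
  rw [hm.2]
  exact h₀ t ht

theorem exists_isSmallestCouple {P : ℤ → ℤ → Prop} (h : ∃ m M, P m M) :
    ∃ m M, IsSmallestCouple P m M := by
  classical
  have hex : ∃ n : ℕ, ∃ m M, P m M ∧ m.natAbs + M.natAbs = n := by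
    obtain ⟨m, M, hP⟩ := h
    exact ⟨_, m, M, hP, rfl⟩
  obtain ⟨m, M, hP, hn⟩ := Nat.find_spec hex
  refine ⟨m, M, hP, fun m₂ M₂ h₂ hm hM => ?_⟩
  have := Nat.find_min' hex ⟨m₂, M₂, h₂, rfl⟩
  rw [Int.abs_eq_natAbs, Int.abs_eq_natAbs] at hm hM ⊢
  rw [Int.abs_eq_natAbs, Int.abs_eq_natAbs]
  omega

theorem exists_isMaxDescent {S : ℤ → ℝ} {v : Triple} {t t' : ℤ} (h1 : v.bot ≤ t) (h2 : t ≤ t')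
    (h3 : t' ≤ v.right) (hlt : S t' < S t) :
    ∃ m₁ M₁, IsMaxDescent S v m₁ M₁ := by
  obtain ⟨⟨M, m⟩, hmem, hmax⟩ := Finset.exists_max_image
    (((Finset.Icc v.bot v.right) ×ˢ (Finset.Icc v.bot v.right)).filter fun q => q.1 ≤ q.2)
    (fun q => S q.1 - S q.2) ⟨(t, t'), by simp; omega⟩
  simp only [Finset.mem_filter, Finset.mem_product, Finset.mem_Icc] at hmem hmax
  have hD := hmax (t, t') ⟨⟨⟨h1, by simp; omega⟩, by simp; omega, h3⟩, h2⟩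
  simp only at hD
  refine ⟨m, M, hmem.1.1.1, lt_of_le_of_ne hmem.2 ?_, hmem.1.2.2, fun s s' a b c => ?_⟩
  · rintro rfl
    linarith
  · exact hmax (s, s') ⟨⟨⟨a, by simp; omega⟩, by simp; omega, c⟩, b⟩

theorem IsRightRefinement.valley_left {S : ℤ → ℝ} {v : Triple} {m₁ M₁ : ℤ} (hv : IsValley S v)
    (h : IsRightRefinement S v m₁ M₁) : IsValley S ⟨v.left, v.bot, M₁⟩ := by
  obtain ⟨⟨h1, h2, h3, h4⟩, -⟩ := h
  refine ⟨hv.left_le, h1, hv.left_max, fun t ht => ?_, fun t ht => hv.bot_min t ⟨ht.1, ?_⟩,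
    fun t ht => hv.bot_abs t ⟨ht.1, ?_⟩⟩
  · have := h4 t m₁ ht.1 (ht.2.trans h2.le) h3
    simp only
    linarith
  · exact ht.2.trans (h2.le.trans h3)
  · exact ht.2.trans (h2.le.trans h3)

theorem IsRightRefinement.valley_right {S : ℤ → ℝ} {v : Triple} {m₁ M₁ : ℤ} (hv : IsValley S v)
    (h : IsRightRefinement S v m₁ M₁) (hlt : S m₁ < S M₁) : IsValley S ⟨M₁, m₁, v.right⟩ := by
  obtain ⟨⟨h1, h2, h3, h4⟩, h5⟩ := h
  refine ⟨h2.le, h3, fun t ht => ?_, fun t ht => ?_, fun t ht => ?_, fun t ht hS => ?_⟩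
  · have := h4 t m₁ (h1.trans ht.1) ht.2 h3
    simp only
    linarith
  · exact hv.right_max t ⟨h1.trans (h2.le.trans ht.1), ht.2⟩
  · have := h4 M₁ t h1 ht.1 ht.2
    simp only
    linarith
  · -- another minimizer closer to `0` would give a smaller couple
    simp only at ht hS ⊢
    by_contra hcon
    have hne : M₁ ≠ t := by
      rintro rfl
      linarith
    have hP : IsMaxDescent S v t M₁ :=
      ⟨h1, lt_of_le_of_ne ht.1 hne, ht.2, by rw [hS]; exact h4⟩
    have := h5 t M₁ hP (not_le.1 hcon).le le_rfl
    omega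

/-- The mirror image of a triple. -/
def Triple.reflect (v : Triple) : Triple := ⟨-v.right, -v.bot, -v.left⟩

@[simp] theorem Triple.reflect_left (v : Triple) : v.reflect.left = -v.right := rfl
@[simp] theorem Triple.reflect_bot (v : Triple) : v.reflect.bot = -v.bot := rfl
@[simp] theorem Triple.reflect_right (v : Triple) : v.reflect.right = -v.left := rfl

@[simp] theorem Triple.reflect_reflect (v : Triple) : v.reflect.reflect = v := by
  cases v; simp [Triple.reflect]

theorem IsValley.reflect {S : ℤ → ℝ} {v : Triple} (h : IsValley S v) :
    IsValley (fun k => S (-k)) v.reflect where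
  left_le := by simpa using h.le_right
  le_right := by simpa using h.left_le
  left_max t ht := by
    simp only [Triple.reflect_left, Triple.reflect_bot, Set.mem_Icc, neg_neg] at ht ⊢
    exact h.right_max _ ⟨by omega, by omega⟩
  right_max t ht := by
    simp only [Triple.reflect_right, Triple.reflect_bot, Set.mem_Icc, neg_neg] at ht ⊢
    exact h.left_max _ ⟨by omega, by omega⟩
  bot_min t ht := by
    simp only [Triple.reflect_right, Triple.reflect_left, Triple.reflect_bot, Set.mem_Icc,
      neg_neg] at ht ⊢
    exact h.bot_min _ ⟨by omega, by omega⟩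
  bot_abs t ht hS := by
    simp only [Triple.reflect_right, Triple.reflect_left, Triple.reflect_bot, Set.mem_Icc,
      neg_neg, abs_neg] at ht hS ⊢
    simpa using h.bot_abs (-t) ⟨by omega, by omega⟩ hS

theorem isMaxAscent_iff_reflect {S : ℤ → ℝ} {v : Triple} {m₁ M₁ : ℤ} :
    IsMaxAscent S v m₁ M₁ ↔ IsMaxDescent (fun k => S (-k)) v.reflect (-m₁) (-M₁) := by
  simp only [IsMaxAscent, IsMaxDescent, Triple.reflect_right, Triple.reflect_bot, neg_neg]
  constructor
  · rintro ⟨h1, h2, h3, h4⟩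
    exact ⟨by omega, by omega, by omega, fun s t a b c =>
      h4 (-t) (-s) (by omega) (by omega) (by omega)⟩
  · rintro ⟨h1, h2, h3, h4⟩
    exact ⟨by omega, by omega, by omega, fun s t a b c => by
      simpa using h4 (-t) (-s) (by omega) (by omega) (by omega)⟩

theorem IsRightRefinement.of_reflect {S : ℤ → ℝ} {v : Triple} {m₁ M₁ : ℤ}
    (h : IsRightRefinement (fun k => S (-k)) v.reflect m₁ M₁) :
    IsLeftRefinement S v (-m₁) (-M₁) := by
  refine ⟨isMaxAscent_iff_reflect.2 (by simpa using h.1), fun m₂ M₂ hP hm hM => ?_⟩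
  simpa using h.2 (-m₂) (-M₂) (isMaxAscent_iff_reflect.1 hP) (by simpa using hm) (by simpa using hM)

theorem RefinesTo.length_le {S : ℤ → ℝ} {v w : Triple} (h : RefinesTo S v w)
    (h1 : v.left ≤ v.bot) (h2 : v.bot ≤ v.right) :
    w.left ≤ w.bot ∧ w.bot ≤ w.right ∧ w.right - w.left ≤ v.right - v.left ∧
      (v.left < v.bot → v.bot < v.right → w.right - w.left < v.right - v.left) := by
  rcases h with ⟨m, M, ⟨⟨a, b, c, -⟩, -⟩, rfl | rfl⟩ | ⟨m, M, ⟨⟨a, b, c, -⟩, -⟩, rfl | rfl⟩ <;>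
    simp only <;> omega

theorem transGen_refinesTo_length_lt {S : ℤ → ℝ} {v w : Triple}
    (h : Relation.TransGen (RefinesTo S) v w) (h1 : v.left < v.bot) (h2 : v.bot < v.right) :
    w.left ≤ w.bot ∧ w.bot ≤ w.right ∧ w.right - w.left < v.right - v.left := by
  induction h with
  | single h =>
    have := h.length_le h1.le h2.le
    exact ⟨this.1, this.2.1, this.2.2.2 h1 h2⟩
  | tail _ h ih =>
    have := h.length_le ih.1 ih.2.1
    exact ⟨this.1, this.2.1, by omega⟩

theorem IsDeepValley.left_lt_bot_lt_right {S : ℤ → ℝ} {Γ δ : ℝ} {v : Triple} (hΓ : 0 < Γ)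
    (h : IsDeepValley S Γ δ v) : v.left < v.bot ∧ v.bot < v.right := by
  have hd := h.depth_ge
  rw [depth, le_min_iff] at hd
  refine ⟨lt_of_le_of_ne h.valley.left_le fun he => ?_,
    lt_of_le_of_ne h.valley.le_right fun he => ?_⟩
  · rw [he] at hd; linarith
  · rw [← he] at hd; linarith

/-- Refinement shortens valleys, so a deep valley refines to a smallest one. -/
theorem IsDeepValley.exists_smallest {S : ℤ → ℝ} {Γ δ : ℝ} {v : Triple} (hΓ : 0 < Γ)
    (h : IsDeepValley S Γ δ v) : ∃ u, IsSmallestDeepValley S Γ δ u := by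
  generalize hn : (v.right - v.left).toNat = n
  induction n using Nat.strong_induction_on generalizing v with
  | _ n ih =>
    by_cases hs : IsSmallestDeepValley S Γ δ v
    · exact ⟨v, hs⟩
    · simp only [IsSmallestDeepValley, h, true_and, not_forall, not_not] at hs
      obtain ⟨w, hvw, hw⟩ := hs
      have h1 := transGen_refinesTo_length_lt hvw
        (h.left_lt_bot_lt_right hΓ).1 (h.left_lt_bot_lt_right hΓ).2
      exact ih _ (by omega) hw rfl

theorem IsSmallestDeepValley.exists_isBasicValley {S : ℤ → ℝ} {Γ δ : ℝ} {u : Triple} (hΓ : 0 < Γ)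
    (h : IsSmallestDeepValley S Γ δ u) :
    ∃ v, IsBasicValley S Γ δ v := by
  have hlt := h.1.left_lt_bot_lt_right hΓ
  have hd := h.1.depth_ge
  rw [depth, le_min_iff] at hd
  obtain ⟨l, hl⟩ := Int.exists_greatest_of_bdd (P := fun l : ℤ => l ≤ 0 ∧ l < u.bot ∧
      Γ ≤ S l - S u.bot ∧ (0 < u.bot → ∀ k ∈ Set.Icc 0 u.bot, δ ≤ S l - S k))
    ⟨0, fun z hz => hz.1⟩ ⟨u.left, h.1.zero_mem.1, hlt.1, hd.1, h.1.margin_pos⟩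
  obtain ⟨r, hr⟩ := Int.exists_least_of_bdd (P := fun l : ℤ => 0 ≤ l ∧ u.bot < l ∧
      Γ ≤ S l - S u.bot ∧ (u.bot < 0 → ∀ k ∈ Set.Icc u.bot 0, δ ≤ S l - S k))
    ⟨0, fun z hz => hz.1⟩ ⟨u.right, h.1.zero_mem.2, hlt.2, hd.2, h.1.margin_neg⟩
  exact ⟨⟨l, u.bot, r⟩, ⟨u, h, rfl⟩, ⟨hl.1, fun z hz => hl.2 z hz⟩, ⟨hr.1, fun z hz => hr.2 z hz⟩⟩

/-! ### Location of the basic valleys -/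

/-- `a` and `b` are the first sites on the left and on the right of `0` with potential at least
`Γ`, and between them the potential, once it has reached `Γ - δ` on one side of `0`, does not
become nonpositive on this side. -/
structure IsFrame (S : ℤ → ℝ) (Γ δ : ℝ) (a b : ℤ) : Prop where
  left_neg : a < 0
  right_pos : 0 < b
  left_ge : Γ ≤ S a
  right_ge : Γ ≤ S b
  lt : ∀ k, a < k → k < b → S k < Γ
  margin_left : ∀ m t, a < m → m ≤ t → t ≤ 0 → S m ≤ 0 → S t < Γ - δ
  margin_right : ∀ m t, m < b → t ≤ m → 0 ≤ t → S m ≤ 0 → S t < Γ - δ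

theorem IsFrame.reflect {S : ℤ → ℝ} {Γ δ : ℝ} {a b : ℤ} (h : IsFrame S Γ δ a b) :
    IsFrame (fun k => S (-k)) Γ δ (-b) (-a) where
  left_neg := by have := h.right_pos; omega
  right_pos := by have := h.left_neg; omega
  left_ge := by simpa using h.right_ge
  right_ge := by simpa using h.left_ge
  lt k h1 h2 := h.lt (-k) (by omega) (by omega)
  margin_left m t h1 h2 h3 h4 := h.margin_right (-m) (-t) (by omega) (by omega) (by omega) h4
  margin_right m t h1 h2 h3 h4 := h.margin_left (-m) (-t) (by omega) (by omega) (by omega) h4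

section Frame

variable {S : ℤ → ℝ} {Γ δ : ℝ} {a b : ℤ}

theorem IsFrame.isDeepValley (h : IsFrame S Γ δ a b) (h0 : S 0 = 0) {w : Triple}
    (hw : IsValley S w) (hl : w.left ≤ a) (hr : b ≤ w.right) (hab : a < w.bot) (hbb : w.bot < b) :
    IsDeepValley S Γ δ w := by
  have hl0 := h.left_neg
  have hr0 := h.right_pos
  have hS : S w.bot ≤ 0 := h0 ▸ hw.bot_min 0 ⟨by omega, by omega⟩
  have h1 : Γ ≤ S w.left := h.left_ge.trans (hw.left_max a ⟨hl, hab.le⟩)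
  have h2 : Γ ≤ S w.right := h.right_ge.trans (hw.right_max b ⟨hbb.le, hr⟩)
  refine ⟨hw, ⟨by omega, by omega⟩, le_min (by linarith) (by linarith), fun _ t ht => ?_,
    fun _ t ht => ?_⟩
  · have := h.margin_left w.bot t hab ht.1 ht.2 hS
    linarith
  · have := h.margin_right w.bot t hbb ht.2 ht.1 hS
    linarith

theorem IsFrame.exists_isDeepValley (h : IsFrame S Γ δ a b) (h0 : S 0 = 0) (hΓ : 0 < Γ) :
    ∃ w, IsDeepValley S Γ δ w := by
  have hl0 := h.left_neg
  have hr0 := h.right_pos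
  obtain ⟨m, hm, h1, h2⟩ := exists_bottom S (show a ≤ b by omega)
  have hS : S m ≤ 0 := h0 ▸ h1 0 ⟨by omega, by omega⟩
  have ham : a < m := lt_of_le_of_ne hm.1 fun he => by
    have := h.left_ge
    rw [he] at this
    linarith
  have hmb : m < b := lt_of_le_of_ne hm.2 fun he => by
    have := h.right_ge
    rw [← he] at this
    linarith
  refine ⟨⟨a, m, b⟩, h.isDeepValley h0 ⟨hm.1, hm.2, fun t ht => ?_, fun t ht => ?_, h1, h2⟩
    le_rfl le_rfl ham hmb⟩
  · rcases ht.1.eq_or_lt with rfl | hlt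
    · exact le_rfl
    · exact (h.lt t hlt (lt_of_le_of_lt ht.2 hmb)).le.trans h.left_ge
  · rcases ht.2.eq_or_lt with rfl | hlt
    · exact le_rfl
    · exact (h.lt t (lt_of_lt_of_le ham ht.1) hlt).le.trans h.right_ge

/-- A valley that contains the frame and whose bottom is on the left of it has a right refinement,
which does not cut the frame, since the largest descent cannot begin inside the frame. -/
theorem IsFrame.exists_rightRefinement (h : IsFrame S Γ δ a b) (h0 : S 0 = 0) (hΓ : 0 < Γ)
    {w : Triple} (hw : IsValley S w) (hl : w.left ≤ a) (hr : b ≤ w.right) (hbot : w.bot ≤ a) :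
    ∃ w' m₁ M₁, IsRightRefinement S w m₁ M₁ ∧
      (w' = ⟨w.left, w.bot, M₁⟩ ∨ w' = ⟨M₁, m₁, w.right⟩) ∧
      IsValley S w' ∧ w'.left ≤ a ∧ b ≤ w'.right ∧ w'.right - w'.left < w.right - w.left := by
  have hl0 := h.left_neg
  have hr0 := h.right_pos
  have ha := h.left_ge
  obtain ⟨m₁, M₁, hR⟩ := exists_isSmallestCouple
    (exists_isMaxDescent (S := S) (v := w) hbot hl0.le (by omega) (by linarith))
  obtain ⟨h1, h2, h3, h4⟩ := hR.1
  have hD := h4 a 0 hbot hl0.le (by omega)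
  have hM : M₁ ≤ a ∨ b ≤ M₁ := by
    by_contra hcon
    push Not at hcon
    have e1 := h.lt M₁ hcon.1 hcon.2
    have e2 := h4 a m₁ hbot (by omega) h3
    linarith
  rcases hM with hM | hM
  · refine ⟨_, m₁, M₁, hR, Or.inr rfl, IsRightRefinement.valley_right hw hR (by linarith), hM, hr,
      ?_⟩
    have hlt : w.bot < M₁ := lt_of_le_of_ne h1 fun he => by
      have := hw.bot_min m₁ ⟨by have := hw.left_le; omega, h3⟩
      rw [he] at this
      linarith
    have := hw.left_le
    simp only
    omega
  · refine ⟨_, m₁, M₁, hR, Or.inl rfl, IsRightRefinement.valley_left hw hR, hl, hM, ?_⟩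
    simp only
    omega

theorem IsFrame.exists_refinesTo (h : IsFrame S Γ δ a b) (h0 : S 0 = 0) (hΓ : 0 < Γ)
    {w : Triple} (hw : IsValley S w) (hl : w.left ≤ a) (hr : b ≤ w.right)
    (hbot : w.bot ≤ a ∨ b ≤ w.bot) :
    ∃ w', RefinesTo S w w' ∧ IsValley S w' ∧ w'.left ≤ a ∧ b ≤ w'.right ∧
      w'.right - w'.left < w.right - w.left := by
  rcases hbot with hbot | hbot
  · obtain ⟨w', m, M, h1, h2, h3⟩ := h.exists_rightRefinement h0 hΓ hw hl hr hbot
    exact ⟨w', Or.inl ⟨m, M, h1, h2⟩, h3⟩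
  · obtain ⟨w', m, M, h1, h2, h3, h4, h5, h6⟩ :=
      h.reflect.exists_rightRefinement (by simpa using h0) hΓ hw.reflect
        (by simpa using hr) (by simpa using hl) (by simpa using hbot)
    simp only [Triple.reflect_left, Triple.reflect_right, Triple.reflect_bot] at h2 h6
    refine ⟨w'.reflect, Or.inr ⟨-m, -M, h1.of_reflect, ?_⟩, by simpa using h3.reflect, ?_⟩
    · rcases h2 with rfl | rfl
      · exact Or.inr (by simp [Triple.reflect])
      · exact Or.inl (by simp [Triple.reflect])
    · simp only [Triple.reflect_left, Triple.reflect_right]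
      omega

theorem IsFrame.exists_reflTransGen (h : IsFrame S Γ δ a b) (h0 : S 0 = 0) (hΓ : 0 < Γ)
    {w : Triple} (hw : IsValley S w) (hl : w.left ≤ a) (hr : b ≤ w.right) :
    ∃ w', Relation.ReflTransGen (RefinesTo S) w w' ∧ IsDeepValley S Γ δ w' ∧
      a < w'.bot ∧ w'.bot < b := by
  generalize hn : (w.right - w.left).toNat = n
  induction n using Nat.strong_induction_on generalizing w with
  | _ n ih =>
    by_cases hb : w.bot ≤ a ∨ b ≤ w.bot
    · obtain ⟨w', h1, h2, h3, h4, h5⟩ := h.exists_refinesTo h0 hΓ hw hl hr hb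
      have := h2.left_le
      have := h2.le_right
      obtain ⟨w'', h6, h7⟩ := ih _ (by omega) h2 h3 h4 rfl
      exact ⟨w'', .head h1 h6, h7⟩
    · push Not at hb
      exact ⟨w, .refl, h.isDeepValley h0 hw hl hr hb.1 hb.2, hb⟩

/-- A smallest deep valley has its bottom in the frame: otherwise it either contains the frame, and
refines to a deep valley, or ends inside the frame, where the potential is below `Γ`. -/
theorem IsFrame.bot_mem (h : IsFrame S Γ δ a b) (h0 : S 0 = 0) (hΓ : 0 < Γ)
    {u : Triple} (hu : IsSmallestDeepValley S Γ δ u) : a < u.bot ∧ u.bot < b := by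
  have hz := hu.1.zero_mem
  have hlt := hu.1.left_lt_bot_lt_right hΓ
  have hv := hu.1.valley
  by_cases hl : u.left ≤ a
  · by_cases hr : b ≤ u.right
    · obtain ⟨w, h1, h2, h3⟩ := h.exists_reflTransGen h0 hΓ hv hl hr
      rcases Relation.reflTransGen_iff_eq_or_transGen.1 h1 with rfl | h4
      · exact h3
      · exact absurd h2 (hu.2 w h4)
    · push Not at hr
      refine ⟨?_, by omega⟩
      by_contra hcon
      have e1 := hv.right_max a ⟨by omega, by have := h.left_neg; have := hz.2; omega⟩
      have e2 := h.lt u.right (by have := h.left_neg; have := hz.2; omega) hr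
      linarith [h.left_ge]
  · push Not at hl
    refine ⟨by omega, ?_⟩
    by_contra hcon
    have e1 := hv.left_max b ⟨by have := h.right_pos; have := hz.1; omega, by omega⟩
    have e2 := h.lt u.left hl (by have := h.right_pos; have := hz.1; omega)
    linarith [h.right_ge]

/-- A basic valley lies between any two sites outside the frame with potential at least `Γ + δ`,
and the potential on it is minimal at the bottom. -/
theorem IsFrame.isBasicValley_bounds (h : IsFrame S Γ δ a b) (h0 : S 0 = 0) (hΓ : 0 < Γ)
    (hδ : 0 ≤ δ) {a' b' : ℤ} (ha : a' ≤ a) (hb : b ≤ b') (hSa : Γ + δ ≤ S a') (hSb : Γ + δ ≤ S b')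
    {v : Triple} (hv : IsBasicValley S Γ δ v) :
    a < v.bot ∧ v.bot < b ∧ a' ≤ v.left ∧ v.right ≤ b' ∧
      ∀ k ∈ Set.Icc v.left v.right, S v.bot ≤ S k := by
  obtain ⟨u, hu, hub⟩ := hv.bot
  have hmem := h.bot_mem h0 hΓ hu
  have hz := hu.1.zero_mem
  have hlt := hu.1.left_lt_bot_lt_right hΓ
  have hd := hu.1.depth_ge
  have hmp := hu.1.margin_pos
  have hmn := hu.1.margin_neg
  have hS0 := hu.1.valley.bot_min 0 hz
  have hmin := hu.1.valley.bot_min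
  rw [depth, le_min_iff] at hd
  rw [hub] at hmem hlt hd hmp hmn hS0 hmin
  have hl0 := h.left_neg
  have hr0 := h.right_pos
  refine ⟨hmem.1, hmem.2, hv.left.2 ⟨by omega, by omega, by linarith, fun _ k hk => ?_⟩,
    hv.right.2 ⟨by omega, by omega, by linarith, fun _ k hk => ?_⟩, fun k hk => hmin k ⟨?_, ?_⟩⟩
  · have := h.lt k (by have := hk.1; omega) (by have := hk.2; omega)
    linarith
  · have := h.lt k (by have := hk.1; omega) (by have := hk.2; omega)
    linarith
  · exact (hv.left.2 ⟨hz.1, hlt.1, hd.1, hmp⟩).trans hk.1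
  · exact hk.2.trans (hv.right.2 ⟨hz.2, hlt.2, hd.2, hmn⟩)

end Frame

/-! ### Good potentials -/

/-- The steps of the potential on the right of `0`. -/
def stepsRight (S : ℤ → ℝ) : ℕ → ℝ := fun i => S (i + 1) - S i

/-- The steps of the potential on the left of `0`, read from right to left. -/
def stepsLeft (S : ℤ → ℝ) : ℕ → ℝ := stepsRight fun k => S (-k)

theorem psum_stepsRight {S : ℤ → ℝ} (h0 : S 0 = 0) (n : ℕ) : psum (stepsRight S) n = S n := by
  induction n with
  | zero => simp [h0]
  | succ n ih => rw [psum_succ, ih, stepsRight]; push_cast; ring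

theorem psum_stepsLeft {S : ℤ → ℝ} (h0 : S 0 = 0) (n : ℕ) : psum (stepsLeft S) n = S (-n) :=
  psum_stepsRight (S := fun k => S (-k)) (by simpa using h0) n

theorem stepsLeft_reflect (S : ℤ → ℝ) : stepsLeft (fun k => S (-k)) = stepsRight S := by
  simp [stepsLeft]

/-- A walk that reaches `Γ + δ` within `N` steps, stays above `-D` as long as it is at most `Γ`,
and does not fall from `Γ - δ` to `0` without exceeding `Γ`. -/
structure IsGoodSide (s : ℕ → ℝ) (Γ δ D : ℝ) (N : ℕ) : Prop where
  hit : ∃ n ≤ N, Γ + δ ≤ psum s n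
  low : ∀ n, (∀ i ≤ n, psum s i ≤ Γ) → -D < psum s n
  margin : ∀ i n, i ≤ n → (∀ j ≤ n, psum s j ≤ Γ) → psum s n ≤ 0 → psum s i < Γ - δ

/-- The first hitting times of `Γ` and of `Γ + δ`. -/
theorem IsGoodSide.exists_hit {s : ℕ → ℝ} {Γ δ D : ℝ} {N : ℕ} (h : IsGoodSide s Γ δ D N)
    (hΓ : 0 < Γ) (hδ : 0 ≤ δ) :
    ∃ b b' : ℕ, 0 < b ∧ b ≤ b' ∧ b' ≤ N ∧ Γ ≤ psum s b ∧ Γ + δ ≤ psum s b' ∧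
      ∀ k < b, psum s k < Γ := by
  classical
  obtain ⟨n, hn, hS⟩ := h.hit
  have hex : ∃ b, Γ ≤ psum s b := ⟨n, by linarith⟩
  refine ⟨Nat.find hex, n, ?_, Nat.find_min' hex (by linarith), hn, Nat.find_spec hex, hS,
    fun k hk => not_le.1 (Nat.find_min hex hk)⟩
  rw [Nat.find_pos, psum_zero]
  linarith

/-- If both sides of the potential are good, basic valleys exist and lie in `[-N, N]`, with a bottom
above `-D` at which the potential is minimal. -/
theorem exists_isBasicValley_and_bounds {S : ℤ → ℝ} {Γ δ D : ℝ} {N : ℕ} (h0 : S 0 = 0)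
    (hΓ : 0 < Γ) (hδ : 0 ≤ δ)
    (hR : IsGoodSide (stepsRight S) Γ δ D N) (hL : IsGoodSide (stepsLeft S) Γ δ D N) :
    (∃ v, IsBasicValley S Γ δ v) ∧
    ∀ v, IsBasicValley S Γ δ v →
      -(N : ℤ) ≤ v.left ∧ v.right ≤ N ∧ -D < S v.bot ∧
        ∀ k ∈ Set.Icc v.left v.right, S v.bot ≤ S k := by
  obtain ⟨b, b', hb0, hbb, hbN, hSb, hSb', hb⟩ := hR.exists_hit hΓ hδ
  obtain ⟨a, a', ha0, haa, haN, hSa, hSa', ha⟩ := hL.exists_hit hΓ hδ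
  simp only [psum_stepsRight h0] at hSb hSb' hb
  simp only [psum_stepsLeft h0] at hSa hSa' ha
  have hlt : ∀ k : ℤ, -(a : ℤ) < k → k < b → S k < Γ := by
    intro k h1 h2
    rcases le_total 0 k with hk | hk
    · lift k to ℕ using hk
      exact hb k (by omega)
    · obtain ⟨j, rfl⟩ := Int.exists_eq_neg_ofNat hk
      exact ha j (by omega)
  have hF : IsFrame S Γ δ (-a) b := by
    refine ⟨by omega, by omega, hSa, hSb, hlt, fun m t h1 h2 h3 h4 => ?_,
      fun m t h1 h2 h3 h4 => ?_⟩
    · obtain ⟨i, rfl⟩ := Int.exists_eq_neg_ofNat h3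
      obtain ⟨n, rfl⟩ := Int.exists_eq_neg_ofNat (h2.trans h3)
      have := hL.margin i n (by omega)
      simp only [psum_stepsLeft h0] at this
      exact this (fun j hj => (ha j (by omega)).le) h4
    · lift t to ℕ using h3
      lift m to ℕ using by omega
      have := hR.margin t m (by omega)
      simp only [psum_stepsRight h0] at this
      exact this (fun j hj => (hb j (by omega)).le) h4
  constructor
  · obtain ⟨w, hw⟩ := hF.exists_isDeepValley h0 hΓ
    obtain ⟨u, hu⟩ := hw.exists_smallest hΓ
    exact hu.exists_isBasicValley hΓ
  · intro v hv
    obtain ⟨h1, h2, h3, h4, h5⟩ := hF.isBasicValley_bounds h0 hΓ hδ (a' := -a') (b' := b')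
      (by omega) (by omega) hSa' hSb' hv
    refine ⟨by omega, by omega, ?_, h5⟩
    rcases le_total 0 v.bot with hk | hk
    · obtain ⟨n, hn⟩ := Int.eq_ofNat_of_zero_le hk
      have := hR.low n
      simp only [psum_stepsRight h0] at this
      rw [hn]
      exact this fun j hj => (hb j (by omega)).le
    · obtain ⟨n, hn⟩ := Int.exists_eq_neg_ofNat hk
      have := hL.low n
      simp only [psum_stepsLeft h0] at this
      rw [hn]
      exact this fun j hj => (ha j (by omega)).le

theorem exists_firstHit {s : ℕ → ℝ} {K x : ℝ} {n : ℕ} (hx : x ≤ 0) (hK0 : 0 ≤ K)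
    (hK : ∀ i, |s i| ≤ K) (hn : psum s n ≤ x) :
    ∃ σ ≤ n, (psum s σ ≤ x ∧ ∀ i < σ, x < psum s i) ∧ x - K ≤ psum s σ := by
  classical
  have hex : ∃ n, psum s n ≤ x := ⟨n, hn⟩
  refine ⟨Nat.find hex, Nat.find_min' hex hn, ⟨Nat.find_spec hex,
    fun i hi => not_le.1 (Nat.find_min hex hi)⟩, ?_⟩
  rcases Nat.eq_zero_or_pos (Nat.find hex) with h | h
  · rw [h, psum_zero]; linarith
  · obtain ⟨j, hj⟩ := Nat.exists_eq_succ_of_ne_zero h.ne'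
    have h1 := not_le.1 (Nat.find_min hex (m := j) (by omega))
    have h2 := abs_le.1 (hK j)
    rw [hj, Nat.succ_eq_add_one, psum_succ]
    linarith

/-- If the potential is low at a site `k` far from the bottom `m ≥ 0` of a valley, then for some
level `-j A` one of two rare events occurs: the walk on the right of `0`, after it has first reached
this level, needs a long time before it climbs to the edge of the valley, without falling much below
the level (if `k ≥ 0`), or the walks on both sides, after they have first reached this level, climb
without falling much below it (if `k < 0`). -/
theorem exists_afterHit_of_low {S : ℤ → ℝ} {Γ D A K : ℝ} {J f : ℕ} (h0 : S 0 = 0) (hA : 0 < A)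
    (hK0 : 0 ≤ K) (hsR : ∀ i, |stepsRight S i| ≤ K) (hsL : ∀ i, |stepsLeft S i| ≤ K)
    (hJ : D ≤ A * (J + 1)) {l m r k : ℤ} (hm : 0 ≤ m) (hl : l ≤ 0) (hmr : m ≤ r)
    (hmin : ∀ t ∈ Set.Icc l r, S m ≤ S t) (hSl : Γ ≤ S l - S m) (hSr : Γ ≤ S r - S m)
    (hD : -D < S m) (hk : k ∈ Set.Icc l r) (hkf : (f : ℤ) < |k - m|) (hSk : S k < S m + A) :
    ∃ j ≤ J, stepsRight S ∈ afterHit (-(j * A)) (dipClimb f (2 * A) (A + K) (Γ - 2 * A)) ∨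
      (stepsRight S ∈ afterHit (-(j * A)) (climbs (2 * A) (Γ - 2 * A)) ∧
        stepsLeft S ∈ afterHit (-(j * A)) (climbs (2 * A) (Γ - 2 * A))) := by
  have hSm : S m ≤ 0 := h0 ▸ hmin 0 ⟨hl, by omega⟩
  -- `j` is the level of the bottom; the events are observed from the level above it
  set j := ⌊-S m / A⌋₊ with hj
  have hj1 : j * A ≤ -S m := by
    have := Nat.floor_le (a := -S m / A) (by apply div_nonneg <;> linarith)
    rwa [← hj, le_div_iff₀ hA] at this
  have hj2 : -S m < (j + 1) * A := by
    have := Nat.lt_floor_add_one (-S m / A)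
    rwa [← hj, div_lt_iff₀ hA] at this
  have hjJ : j ≤ J := by
    have : (j : ℝ) * A < (J + 1) * A := by linarith
    have := lt_of_mul_lt_mul_right this hA.le
    exact_mod_cast Nat.lt_succ_iff.1 (by exact_mod_cast this)
  set i := j - 1 with hi
  have hi1 : (i : ℝ) * A ≤ j * A := by
    have : (i : ℝ) ≤ j := by exact_mod_cast (by omega : i ≤ j)
    gcongr
  have hi2 : (j : ℝ) * A ≤ i * A + A := by
    have : (j : ℝ) ≤ i + 1 := by exact_mod_cast (by omega : j ≤ i + 1)
    nlinarith
  have hx : -(i * A) ≤ 0 := by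
    have : 0 ≤ (i : ℝ) * A := by positivity
    linarith
  have hlow : j ≠ 0 → S k ≤ -(i * A) := by
    intro hj0
    have : (i : ℝ) + 1 = j := by exact_mod_cast (by omega : i + 1 = j)
    rw [← this] at hj1
    linarith
  refine ⟨i, by omega, ?_⟩
  lift m to ℕ using hm
  obtain ⟨R, rfl⟩ : ∃ R : ℕ, r = R := ⟨r.toNat, by omega⟩
  have hminR : ∀ t : ℕ, t ≤ R → S m ≤ psum (stepsRight S) t := fun t ht => by
    rw [psum_stepsRight h0]
    exact hmin t ⟨by omega, by omega⟩
  have hSR : Γ ≤ psum (stepsRight S) R - S m := by rwa [psum_stepsRight h0]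
  -- the walk on the right climbs after its first visit below `-(i * A)`
  have climbR : ∀ σ ≤ R, psum (stepsRight S) σ ≤ -(i * A) →
      (∀ q ≤ R - σ, -(2 * A) ≤ psum (shift σ (stepsRight S)) q) ∧
        Γ - 2 * A ≤ psum (shift σ (stepsRight S)) (R - σ) := by
    intro σ hσ hS
    constructor
    · intro q hq
      rw [psum_shift]
      have := hminR (σ + q) (by omega)
      linarith
    · rw [psum_shift, show σ + (R - σ) = R by omega]
      linarith
  rcases le_or_gt 0 k with hk0 | hk0
  · left
    lift k to ℕ using hk0
    have hkR : k ≤ R := by have := hk.2; omega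
    have hmem : ∃ σ ≤ min k m, (psum (stepsRight S) σ ≤ -(i * A) ∧
        ∀ q < σ, -(i * A) < psum (stepsRight S) q) ∧ -(i * A) - K ≤ psum (stepsRight S) σ := by
      by_cases hj0 : j = 0
      · obtain ⟨σ, h1, h2⟩ := exists_firstHit (n := 0) hx hK0 hsR
          (by rw [psum_zero, show i = 0 by omega]; simp)
        exact ⟨σ, by omega, h2⟩
      · refine exists_firstHit (n := min k m) hx hK0 hsR ?_
        rw [psum_stepsRight h0]
        rcases min_choice k m with hc | hc <;> rw [hc]
        · exact hlow hj0
        · linarith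
    obtain ⟨σ, hσ, hσ1, hσ2⟩ := hmem
    obtain ⟨h1, h2⟩ := climbR σ (by omega) hσ1.1
    refine ⟨σ, hσ1, max k m - σ, R - σ, ?_, by omega, h1, ?_, h2⟩
    · have : (f : ℤ) < max (k : ℤ) m - min (k : ℤ) m := by
        rwa [max_sub_min_eq_abs', abs_sub_comm, abs_sub_comm] at *
      omega
    · rw [psum_shift, show σ + (max k m - σ) = max k m by omega, psum_stepsRight h0]
      rcases max_choice k m with hc | hc <;> rw [hc] <;> linarith
  · right
    obtain ⟨σ, hσ, hσ1, -⟩ := exists_firstHit (n := m) hx hK0 hsR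
      (by rw [psum_stepsRight h0]; linarith)
    refine ⟨⟨σ, hσ1, R - σ, climbR σ (by omega) hσ1.1⟩, ?_⟩
    obtain ⟨n, rfl⟩ := Int.exists_eq_neg_ofNat hk0.le
    obtain ⟨q, rfl⟩ := Int.exists_eq_neg_ofNat hl
    have hnq : n ≤ q := by have := hk.1; omega
    have hmem : ∃ σ ≤ n, (psum (stepsLeft S) σ ≤ -(i * A) ∧
        ∀ q < σ, -(i * A) < psum (stepsLeft S) q) ∧ -(i * A) - K ≤ psum (stepsLeft S) σ := by
      by_cases hj0 : j = 0
      · obtain ⟨σ, h1, h2⟩ := exists_firstHit (n := 0) hx hK0 hsL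
          (by rw [psum_zero, show i = 0 by omega]; simp)
        exact ⟨σ, by omega, h2⟩
      · refine exists_firstHit (n := n) hx hK0 hsL ?_
        rw [psum_stepsLeft h0]
        exact hlow hj0
    obtain ⟨τ, hτ, hτ1, -⟩ := hmem
    refine ⟨τ, hτ1, q - τ, fun p hp => ?_, ?_⟩
    · rw [psum_shift, psum_stepsLeft h0 (τ + p)]
      have := hmin (-((τ + p : ℕ) : ℤ)) ⟨by omega, by omega⟩
      linarith [hτ1.1]
    · rw [psum_shift, show τ + (q - τ) = q by omega, psum_stepsLeft h0 q]
      linarith [hτ1.1]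

/-! ### Local time of an excursion -/

/-- The walk started at `m` is at `k` at time `i` and has not returned to `m` before time `i`. -/
def noReturn (m k : ℤ) (i : ℕ) : Set (ℕ → ℤ) := {X | X i = k ∧ ∀ l, 1 ≤ l → l < i → X l ≠ m}

theorem measurableSet_eval_eq (i : ℕ) (k : ℤ) : MeasurableSet {X : ℕ → ℤ | X i = k} :=
  measurableSet_eq_fun (by fun_prop) measurable_const

theorem measurableSet_noReturn (m k : ℤ) (i : ℕ) : MeasurableSet (noReturn m k i) := by
  simp only [noReturn, Set.ofPred_and, Set.ofPred_forall]
  refine MeasurableSet.inter (measurableSet_eval_eq i k) (.iInter fun l =>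
    .iInter fun _ => .iInter fun _ => ?_)
  exact (measurableSet_eval_eq l m).compl

theorem stepMeasure_singleton (e : Env) (j k : ℤ) :
    stepMeasure e j {k} = (if j = k - 1 then ENNReal.ofReal (e j) else 0)
      + (if j = k + 1 then ENNReal.ofReal (1 - e j) else 0) := by
  have h1 : j + 1 = k ↔ j = k - 1 := by omega
  have h2 : j - 1 = k ↔ j = k + 1 := by omega
  simp [stepMeasure, Set.indicator_apply, h1, h2]

/-- The Markov property at a fixed time. -/
theorem walkLaw_succ (e : Env) (x j k : ℤ) (n : ℕ) {A : Set (Finset.Iic n → ℤ)}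
    (hA : MeasurableSet A)
    (hAj : ∀ y ∈ A, y ⟨n, Finset.mem_Iic.2 le_rfl⟩ = j) :
    walkLaw e x {X | Preorder.frestrictLe n X ∈ A ∧ X (n + 1) = k} =
      walkLaw e x {X | Preorder.frestrictLe n X ∈ A} * stepMeasure e j {k} := by
  have h := Kernel.partialTraj_compProd_eq_map_traj (X := fun _ => ℤ) (κ := stepKernel e)
    (Nat.zero_le n) (x₀ := fun _ => x)
  have h2 := Kernel.traj_map_frestrictLe_apply (X := fun _ => ℤ) (κ := stepKernel e) 0 n
    (fun _ => x)
  rw [← h2] at h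
  change Measure.map _ (walkLaw e x) ⊗ₘ _ = Measure.map _ (walkLaw e x) at h
  have h1 : _ = _ := congrArg (fun μ => μ (A ×ˢ {k})) h
  rw [Measure.compProd_apply_prod hA (measurableSet_singleton k), Measure.map_apply
    (by fun_prop) (hA.prod (measurableSet_singleton k)), setLIntegral_congr_fun
    (g := fun _ => stepMeasure e j {k}) hA (fun y hy => by rw [← hAj y hy]; rfl),
    setLIntegral_const, Measure.map_apply (by fun_prop) hA, mul_comm] at h1
  exact h1.symm

theorem walkLaw_noReturn_succ_inter (e : Env) (m j k : ℤ) {i : ℕ} (hi : 1 ≤ i) :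
    walkLaw e m (noReturn m k (i + 1) ∩ {X | X i = j}) =
      if j = m then 0 else walkLaw e m (noReturn m j i) * stepMeasure e j {k} := by
  split_ifs with hj
  · have : noReturn m k (i + 1) ∩ {X | X i = j} = ∅ := by
      ext X
      simp only [noReturn, Set.mem_inter_iff, Set.mem_ofPred_eq, Set.mem_empty_iff_false, iff_false]
      rintro ⟨⟨-, h⟩, h'⟩
      exact h i hi (by omega) (h'.trans hj)
    rw [this, measure_empty]
  · set A : Set (Finset.Iic i → ℤ) := {y | y ⟨i, Finset.mem_Iic.2 le_rfl⟩ = j ∧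
      ∀ l : Finset.Iic i, 1 ≤ l.1 → l.1 < i → y l ≠ m}
    have h := walkLaw_succ e m j k i (A := A) (Set.to_countable A).measurableSet fun y hy => hy.1
    have e1 : {X : ℕ → ℤ | Preorder.frestrictLe i X ∈ A} = noReturn m j i := by
      ext X
      simp only [A, noReturn, Set.mem_ofPred_eq]
      exact and_congr Iff.rfl ⟨fun h l h1 h2 => h ⟨l, Finset.mem_Iic.2 h2.le⟩ h1 h2,
        fun h l h1 h2 => h l h1 h2⟩
    have e2 : {X : ℕ → ℤ | Preorder.frestrictLe i X ∈ A ∧ X (i + 1) = k} =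
        noReturn m k (i + 1) ∩ {X | X i = j} := by
      ext X
      have : Preorder.frestrictLe i X ∈ A ↔ X ∈ noReturn m j i := by rw [← e1]; rfl
      simp only [Set.mem_ofPred_eq, this, Set.mem_inter_iff]
      simp only [noReturn, Set.mem_ofPred_eq]
      constructor
      · rintro ⟨⟨h1, h2⟩, h3⟩
        refine ⟨⟨h3, fun l hl1 hl2 => ?_⟩, h1⟩
        rcases Nat.lt_succ_iff_lt_or_eq.1 hl2 with h | rfl
        · exact h2 l hl1 h
        · rwa [h1]
      · rintro ⟨⟨h1, h2⟩, h3⟩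
        exact ⟨⟨h3, fun l hl1 hl2 => h2 l hl1 (by omega)⟩, h1⟩
    rw [e1, e2] at h
    exact h

theorem walkLaw_noReturn_succ (e : Env) (m k : ℤ) {i : ℕ} (hi : 1 ≤ i) :
    walkLaw e m (noReturn m k (i + 1)) =
      (if k - 1 = m then 0 else walkLaw e m (noReturn m (k - 1) i) * ENNReal.ofReal (e (k - 1)))
      + (if k + 1 = m then 0 else
          walkLaw e m (noReturn m (k + 1) i) * ENNReal.ofReal (1 - e (k + 1))) := by
  have hU : noReturn m k (i + 1) = ⋃ j : ℤ, noReturn m k (i + 1) ∩ {X | X i = j} := by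
    ext X; simp
  rw [hU, measure_iUnion]
  · simp only [walkLaw_noReturn_succ_inter e m _ k hi, stepMeasure_singleton]
    have : ∀ j : ℤ, (if j = m then 0 else walkLaw e m (noReturn m j i) *
        ((if j = k - 1 then ENNReal.ofReal (e j) else 0)
          + (if j = k + 1 then ENNReal.ofReal (1 - e j) else 0))) =
        (if j = k - 1 then (if j = m then 0 else
          walkLaw e m (noReturn m j i) * ENNReal.ofReal (e j)) else 0)
        + (if j = k + 1 then (if j = m then 0 else
          walkLaw e m (noReturn m j i) * ENNReal.ofReal (1 - e j)) else 0) := by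
      intro j
      split_ifs <;> simp [mul_add]
    simp only [this]
    rw [ENNReal.tsum_add, tsum_ite_eq, tsum_ite_eq]
  · intro a b hab
    refine Set.disjoint_left.2 fun X h1 h2 => hab (h1.2.symm.trans h2.2)
  · exact fun j => (measurableSet_noReturn m k _).inter
      (measurableSet_eval_eq i j)

theorem walkLaw_noReturn_one (e : Env) (m k : ℤ) :
    walkLaw e m (noReturn m k 1) = stepMeasure e m {k} := by
  have h := Kernel.map_traj_succ_self (X := fun _ => ℤ) (κ := stepKernel e) (a := 0)
  have h1 : Kernel.map _ _ _ _ = _ := congrArg (fun κ => κ (fun _ => m) {k}) h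
  rw [Kernel.map_apply' _ (by fun_prop) _ (measurableSet_singleton k)] at h1
  have e1 : noReturn m k 1 = (fun X : ℕ → ℤ => X (0 + 1)) ⁻¹' {k} := by
    ext X
    simp only [noReturn, Set.mem_ofPred_eq, Set.mem_preimage, Set.mem_singleton_iff, zero_add,
      and_iff_left_iff_imp]
    intro _ l h1 h2
    omega
  rw [e1]
  exact h1

/-- The reversible measure of the walk. -/
noncomputable def revMeasure (e : Env) (k : ℤ) : ℝ := Real.exp (-potential e k) / e k

theorem revMeasure_pos (e : Env) (k : ℤ) : 0 < revMeasure e k :=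
  div_pos (Real.exp_pos _) (e k).2.1

theorem revMeasure_invariant (e : Env) (k : ℤ) :
    revMeasure e (k - 1) * e (k - 1) + revMeasure e (k + 1) * (1 - e (k + 1)) = revMeasure e k := by
  have ha : ∀ i, (0 : ℝ) < e i := fun i => (e i).2.1
  have hb : ∀ i, (0 : ℝ) < 1 - e i := fun i => sub_pos.2 (e i).2.2
  have hS : ∀ i, Real.exp (-potential e (i - 1)) =
      Real.exp (-potential e i) * ((1 - e i) / e i) := by
    intro i
    have := potential_sub e i
    rw [show -potential e (i - 1) = -potential e i + logRatio (e i) by linarith, Real.exp_add,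
      logRatio, Real.exp_log (div_pos (hb i) (ha i))]
  have h1 : revMeasure e (k - 1) * e (k - 1) = Real.exp (-potential e (k - 1)) :=
    div_mul_cancel₀ _ (ha _).ne'
  have h2 : revMeasure e (k + 1) * (1 - e (k + 1)) = Real.exp (-potential e k) := by
    have := hS (k + 1)
    rw [add_sub_cancel_right] at this
    rw [this, revMeasure]
    ring
  rw [h1, h2, hS k, revMeasure]
  have := (ha k).ne'
  field_simp
  ring

/-- Truncated expected local times satisfy the recursion of which the normalized reversible measure
is a supersolution. -/
theorem sum_walkLaw_noReturn_le (e : Env) (m : ℤ) (N : ℕ) (k : ℤ) :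
    ∑ i ∈ Finset.range N, walkLaw e m (noReturn m k (i + 1)) ≤
      ENNReal.ofReal (revMeasure e k / revMeasure e m) := by
  induction N generalizing k with
  | zero => simp
  | succ N ih =>
    have hm := revMeasure_pos e m
    have ha : ∀ i, (0 : ℝ) ≤ e i := fun i => (e i).2.1.le
    have hb : ∀ i, (0 : ℝ) ≤ 1 - e i := fun i => sub_nonneg.2 (e i).2.2.le
    have hr : ∀ i, 0 ≤ revMeasure e i / revMeasure e m := fun i =>
      (div_pos (revMeasure_pos e i) hm).le
    have hinv : ENNReal.ofReal (revMeasure e k / revMeasure e m) =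
        ENNReal.ofReal (revMeasure e (k - 1) / revMeasure e m) * ENNReal.ofReal (e (k - 1)) +
        ENNReal.ofReal (revMeasure e (k + 1) / revMeasure e m) *
          ENNReal.ofReal (1 - e (k + 1)) := by
      rw [← ENNReal.ofReal_mul (hr _), ← ENNReal.ofReal_mul (hr _),
        ← ENNReal.ofReal_add (mul_nonneg (hr _) (ha _)) (mul_nonneg (hr _) (hb _)),
        ← revMeasure_invariant e k]
      congr 1
      ring
    rw [Finset.sum_range_succ', walkLaw_noReturn_one, stepMeasure_singleton]
    simp only [walkLaw_noReturn_succ e m k (Nat.le_add_left 1 _)]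
    rw [Finset.sum_add_distrib, hinv, add_add_add_comm]
    have hone : ENNReal.ofReal (revMeasure e m / revMeasure e m) = 1 := by
      rw [div_self hm.ne', ENNReal.ofReal_one]
    refine add_le_add ?_ ?_
    · by_cases h : k - 1 = m
      · simp [h, hone]
      · have h' : ¬ m = k - 1 := fun h' => h h'.symm
        simp only [h, h', if_false, add_zero, ← Finset.sum_mul]
        gcongr
        exact ih (k - 1)
    · by_cases h : k + 1 = m
      · simp [h, hone]
      · have h' : ¬ m = k + 1 := fun h' => h h'.symm
        simp only [h, h', if_false, add_zero, ← Finset.sum_mul]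
        gcongr
        exact ih (k + 1)

theorem le_hittingTime_iff (m : ℤ) (X : ℕ → ℤ) (i : ℕ) :
    (i : ℕ∞) ≤ hittingTime m X ↔ ∀ l, 1 ≤ l → l < i → X l ≠ m := by
  simp only [hittingTime, le_iInf_iff, Nat.cast_le]
  constructor
  · intro h l h1 h2 h3
    have := h l ⟨h1, h3⟩
    omega
  · rintro h l ⟨h1, h2⟩
    by_contra hcon
    exact h l h1 (not_le.1 hcon) h2

theorem excursionLocalTime_le (e : Env) (m : ℤ) (V : Set ℤ) :
    excursionLocalTime e m V ≤
      ∑' k : V, ENNReal.ofReal (revMeasure e k / revMeasure e m) := by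
  classical
  have hind : ∀ (k : ℤ) (i : ℕ) (X : ℕ → ℤ),
      (if 1 ≤ i ∧ (i : ℕ∞) ≤ hittingTime m X ∧ X i = k then (1 : ℝ≥0∞) else 0) =
        if i = 0 then 0 else (noReturn m k i).indicator 1 X := by
    intro k i X
    by_cases hi : i = 0
    · simp [hi]
    · have : 1 ≤ i := by omega
      simp [hi, this, noReturn, Set.indicator_apply, and_comm, le_hittingTime_iff]
  have hmeas : ∀ (k : ℤ) (i : ℕ), Measurable fun X : ℕ → ℤ =>
      if i = 0 then (0 : ℝ≥0∞) else (noReturn m k i).indicator 1 X := by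
    intro k i
    by_cases hi : i = 0
    · simp [hi]
    · simpa only [hi, if_false] using measurable_one.indicator (measurableSet_noReturn m k i)
  have hloc : ∀ (X : ℕ → ℤ) (k : ℤ), localTime k (hittingTime m X) X =
      ∑' i : ℕ, if i = 0 then 0 else (noReturn m k i).indicator 1 X := by
    intro X k
    refine tsum_congr fun i => ?_
    rw [← hind k i X]
  simp only [excursionLocalTime, localTimeSet, hloc]
  rw [lintegral_tsum fun k : V => (Measurable.tsum fun i => hmeas k i).aemeasurable]
  refine ENNReal.tsum_le_tsum fun k => ?_
  rw [lintegral_tsum fun i => (hmeas k i).aemeasurable, ENNReal.tsum_eq_iSup_nat]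
  refine iSup_le fun N => ?_
  refine le_trans (Finset.sum_le_sum_of_subset (Finset.range_mono (Nat.le_succ N))) ?_
  rw [Finset.sum_range_succ']
  simp only [Nat.add_eq_zero_iff, one_ne_zero, and_false, if_false, if_true, lintegral_zero,
    add_zero]
  refine le_trans (le_of_eq (Finset.sum_congr rfl fun i _ => ?_)) (sum_walkLaw_noReturn_le e m N k)
  exact lintegral_indicator_one (measurableSet_noReturn m k (i + 1))

theorem sum_inv_sq_le {m : ℤ} {f : ℕ} (hf : f ≠ 0) (F : Finset ℤ)
    (hF : ∀ k ∈ F, (f : ℤ) < |k - m|) :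
    ∑ k ∈ F, (((k - m : ℤ) : ℝ) ^ 2)⁻¹ ≤ 2 / f := by
  classical
  set R := F.sup (fun k => (k - m).natAbs) with hR
  set R' := max R f
  have hsub : F ⊆ (Finset.Ioc f R').image (fun i : ℕ => m + (i : ℤ)) ∪
      (Finset.Ioc f R').image (fun i : ℕ => m - (i : ℤ)) := by
    intro k hk
    have h1 := hF k hk
    have h2 : (k - m).natAbs ≤ R := Finset.le_sup (f := fun k => (k - m).natAbs) hk
    rw [Finset.mem_union, Finset.mem_image, Finset.mem_image]
    rw [Int.abs_eq_natAbs] at h1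
    rcases le_total m k with h | h
    · exact Or.inl ⟨(k - m).natAbs, Finset.mem_Ioc.2 ⟨by omega, by omega⟩, by omega⟩
    · exact Or.inr ⟨(k - m).natAbs, Finset.mem_Ioc.2 ⟨by omega, by omega⟩, by omega⟩
  have hsum : ∑ i ∈ Finset.Ioc f R', ((i : ℝ) ^ 2)⁻¹ ≤ 1 / f := by
    have := sum_Ioc_inv_sq_le_sub (α := ℝ) hf (le_max_right R f)
    have h2 : (0 : ℝ) ≤ ((max R f : ℕ) : ℝ)⁻¹ := by positivity
    rw [one_div]
    linarith
  calc ∑ k ∈ F, (((k - m : ℤ) : ℝ) ^ 2)⁻¹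
      ≤ ∑ k ∈ (Finset.Ioc f R').image (fun i : ℕ => m + (i : ℤ)) ∪
          (Finset.Ioc f R').image (fun i : ℕ => m - (i : ℤ)), (((k - m : ℤ) : ℝ) ^ 2)⁻¹ :=
        Finset.sum_le_sum_of_subset_of_nonneg hsub fun _ _ _ => by positivity
    _ ≤ ∑ k ∈ (Finset.Ioc f R').image (fun i : ℕ => m + (i : ℤ)), (((k - m : ℤ) : ℝ) ^ 2)⁻¹ +
        ∑ k ∈ (Finset.Ioc f R').image (fun i : ℕ => m - (i : ℤ)), (((k - m : ℤ) : ℝ) ^ 2)⁻¹ := by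
        rw [← Finset.sum_union_inter]
        exact le_add_of_nonneg_right (Finset.sum_nonneg fun _ _ => by positivity)
    _ = ∑ i ∈ Finset.Ioc f R', ((i : ℝ) ^ 2)⁻¹ + ∑ i ∈ Finset.Ioc f R', ((i : ℝ) ^ 2)⁻¹ := by
        rw [Finset.sum_image (by intro a _ b _ h; simpa using h),
          Finset.sum_image (by intro a _ b _ h; simpa using h)]
        simp
    _ ≤ 2 / f := by
        rw [show (2 : ℝ) / f = 1 / f + 1 / f by ring]
        exact add_le_add hsum hsum

/-- If the potential grows at least like `2 log |k - m|` on `V`, then the expected local time in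
`V` during an excursion from `m` is bounded by a convergent series. -/
theorem excursionLocalTime_le_of_log_le {e : Env} {m : ℤ} {V : Set ℤ} {f : ℕ} {η : ℝ}
    (hη : 0 < η) (he : ∀ i, η ≤ (e i : ℝ) ∧ (e i : ℝ) ≤ 1 - η) (hfη : 1 ≤ η * f) (hfin : V.Finite)
    (hf : ∀ k ∈ V, (f : ℤ) < |k - m|)
    (hV : ∀ k ∈ V, 2 * Real.log |((k - m : ℤ) : ℝ)| ≤ potential e k - potential e m) :
    excursionLocalTime e m V ≤ ENNReal.ofReal (2 / η * (1 / ((f : ℝ) + 1))) := by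
  have hη1 : η < 1 := by
    have := (he 0).1.trans (he 0).2
    linarith
  have hf0 : f ≠ 0 := by
    rintro rfl
    simp at hfη
    linarith
  have hfpos : (0 : ℝ) < f := by positivity
  refine (excursionLocalTime_le e m V).trans ?_
  have hterm : ∀ k ∈ V, revMeasure e k / revMeasure e m ≤
      (1 - η) / η * (((k - m : ℤ) : ℝ) ^ 2)⁻¹ := by
    intro k hk
    have hkm : (0 : ℝ) < |((k - m : ℤ) : ℝ)| := by
      rw [abs_pos]
      have := hf k hk
      exact_mod_cast (abs_pos.1 (by omega : 0 < |k - m|))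
    have h1 : Real.exp (-(potential e k - potential e m)) ≤ (((k - m : ℤ) : ℝ) ^ 2)⁻¹ := by
      rw [← sq_abs, ← Real.exp_log (pow_pos hkm 2), ← Real.exp_neg, Real.exp_le_exp, Real.log_pow]
      have := hV k hk
      push_cast at this ⊢
      linarith
    have h2 : (e m : ℝ) / e k ≤ (1 - η) / η :=
      div_le_div₀ (by linarith) (he m).2 hη (he k).1
    have h3 : revMeasure e k / revMeasure e m =
        (e m : ℝ) / e k * Real.exp (-(potential e k - potential e m)) := by
      rw [revMeasure, revMeasure, show -(potential e k - potential e m) =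
        -potential e k - -potential e m by ring, Real.exp_sub]
      have := (e m).2.1.ne'
      have := (e k).2.1.ne'
      have := Real.exp_ne_zero (-potential e m)
      field_simp
    rw [h3]
    exact mul_le_mul h2 h1 (Real.exp_pos _).le (div_nonneg (by linarith) hη.le)
  lift V to Finset ℤ using hfin
  have hnn : ∀ k : ℤ, 0 ≤ (1 - η) / η * (((k - m : ℤ) : ℝ) ^ 2)⁻¹ := fun k =>
    mul_nonneg (div_nonneg (by linarith) hη.le) (by positivity)
  calc ∑' k : (V : Set ℤ), ENNReal.ofReal (revMeasure e k / revMeasure e m)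
      = ∑ k ∈ V, ENNReal.ofReal (revMeasure e k / revMeasure e m) :=
        Finset.tsum_subtype' V fun k => ENNReal.ofReal (revMeasure e k / revMeasure e m)
    _ ≤ ∑ k ∈ V, ENNReal.ofReal ((1 - η) / η * (((k - m : ℤ) : ℝ) ^ 2)⁻¹) :=
        Finset.sum_le_sum fun k hk => ENNReal.ofReal_le_ofReal (hterm k hk)
    _ = ENNReal.ofReal ((1 - η) / η * ∑ k ∈ V, (((k - m : ℤ) : ℝ) ^ 2)⁻¹) := by
        rw [← ENNReal.ofReal_sum_of_nonneg fun k _ => hnn k, Finset.mul_sum]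
    _ ≤ _ := by
        refine ENNReal.ofReal_le_ofReal ?_
        have h1 := mul_le_mul_of_nonneg_left (sum_inv_sq_le hf0 V hf)
          (div_nonneg (by linarith : 0 ≤ 1 - η) hη.le)
        refine h1.trans ?_
        rw [div_mul_div_comm, div_mul_div_comm, div_le_div_iff₀ (by positivity) (by positivity)]
        -- this is `(1 - η) (f + 1) ≤ f`
        have : (1 - η) * (f + 1) ≤ f := by nlinarith
        nlinarith [mul_le_mul_of_nonneg_left this hη.le]

/-! ### Probability of a bad potential -/

/-- The rare events for the walk on one side of `0`: it does not reach `Γ + δ` in `N` steps; it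
reaches `-D` before it exceeds `Γ`; it falls from `Γ - δ` to `0` before it exceeds `Γ`; after
its first visit below some level `-j A`, it does not fall far below this level for `f` steps, is
near it later, and climbs to about `Γ` after that. -/
def badSide (Γ δ D A K : ℝ) (N J f : ℕ) : Set (ℕ → ℝ) :=
  (Neg.neg ⁻¹' stays (Γ + δ) N ∪ Neg.neg ⁻¹' climbs Γ D ∪
    Neg.neg ⁻¹' afterHit (δ - Γ) (climbs δ (Γ - δ))) ∪
  ⋃ j ∈ Finset.range (J + 1), afterHit (-((j : ℝ) * A)) (dipClimb f (2 * A) (A + K) (Γ - 2 * A))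

/-- The walk climbs to about `Γ` after its first visit below `-j A`, without falling much lower. -/
def tieSide (Γ A : ℝ) (j : ℕ) : Set (ℕ → ℝ) :=
  afterHit (-((j : ℝ) * A)) (climbs (2 * A) (Γ - 2 * A))

theorem measurableSet_tieSide (Γ A : ℝ) (j : ℕ) : MeasurableSet (tieSide Γ A j) :=
  measurableSet_afterHit _ (measurableSet_climbs _ _)

theorem measurableSet_badSide (Γ δ D A K : ℝ) (N J f : ℕ) :
    MeasurableSet (badSide Γ δ D A K N J f) := by
  refine (((measurable_neg (measurableSet_stays _ _)).union
    (measurable_neg (measurableSet_climbs _ _))).union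
    (measurable_neg (measurableSet_afterHit _ (measurableSet_climbs _ _)))).union ?_
  exact Finset.measurableSet_biUnion _ fun j _ =>
    measurableSet_afterHit _ (measurableSet_dipClimb _ _ _ _)

theorem isGoodSide_of_notMem {Γ δ D A K : ℝ} {N J f : ℕ} {s : ℕ → ℝ}
    (hs : s ∉ badSide Γ δ D A K N J f) : IsGoodSide s Γ δ D N := by
  simp only [badSide, Set.mem_union, not_or] at hs
  obtain ⟨⟨⟨h1, h2⟩, h3⟩, -⟩ := hs
  refine ⟨?_, fun n hn => ?_, fun i n hin hn hn0 => ?_⟩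
  · by_contra hcon
    push Not at hcon
    exact h1 fun i hi => by rw [psum_neg]; linarith [hcon i hi]
  · by_contra hcon
    exact h2 ⟨n, fun i hi => by rw [psum_neg]; linarith [hn i hi], by rw [psum_neg]; linarith⟩
  · by_contra hcon
    push Not at hcon
    classical
    have hex : ∃ i, psum (-s) i ≤ δ - Γ := ⟨i, by rw [psum_neg]; linarith⟩
    have hle : Nat.find hex ≤ i := Nat.find_min' hex (by rw [psum_neg]; linarith)
    have hsp := Nat.find_spec hex
    refine h3 ⟨Nat.find hex, ⟨hsp, fun q hq => not_le.1 (Nat.find_min hex hq)⟩,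
      n - Nat.find hex, fun q hq => ?_, ?_⟩
    · rw [psum_shift, psum_neg s (_ + _)]
      linarith [hn (Nat.find hex + q) (by omega)]
    · rw [psum_shift, show Nat.find hex + (n - Nat.find hex) = n by omega, psum_neg s n]
      linarith

section

variable {μ : Measure ℝ} [IsProbabilityMeasure μ] {K v : ℝ}

theorem seqLaw_neg_preimage [IsProbabilityMeasure (μ.map fun x => -x)] {E : Set (ℕ → ℝ)}
    (hE : MeasurableSet E) : seqLaw μ (Neg.neg ⁻¹' E) = seqLaw (μ.map fun x => -x) E := by
  rw [← map_neg_seqLaw, Measure.map_apply measurable_neg hE]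

theorem IsStepLaw.seqLaw_tieSide_le (h : IsStepLaw μ K v) {Γ A : ℝ} (hΓ : 0 < Γ) (hA : 0 < A)
    (j : ℕ) : seqLaw μ (tieSide Γ A j) ≤ ENNReal.ofReal ((2 * A + K) / Γ) := by
  have hK := h.bound_pos
  refine (seqLaw_afterHit_le _ (measurableSet_climbs _ _)).trans ?_
  have := h.seqLaw_climbs_le (a := 2 * A) (e := Γ - 2 * A) (by linarith) (by linarith)
  rwa [show 2 * A + (Γ - 2 * A) = Γ by ring] at this

/-- The bound for the probability of `badSide`, in which `c` depends on the step law only. -/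
noncomputable def badBound (c Γ δ D A K : ℝ) (N J f : ℕ) : ℝ :=
  c * (Γ + δ + K) / √(N + 1) + (Γ + K) / (Γ + D) + (δ + K) / Γ +
    (J + 1) * (c * (2 * A + K) / √(f + 1) * ((3 * A + 2 * K) / Γ))

theorem IsStepLaw.seqLaw_badSide_le (h : IsStepLaw μ K v) {Γ δ D A : ℝ} (hΓ : 0 < Γ) (hδ : 0 ≤ δ)
    (hD : 0 < D) (hA : 0 < A) (N J f : ℕ) :
    seqLaw μ (badSide Γ δ D A K N J f) ≤
      ENNReal.ofReal (badBound (1 + (1 + 2 * K) / v) Γ δ D A K N J f) := by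
  have hK := h.bound_pos
  have hv := h.var_pos
  have hc : 0 < 1 + (1 + 2 * K) / v := by positivity
  have : IsProbabilityMeasure (μ.map fun x => -x) :=
    Measure.isProbabilityMeasure_map measurable_neg.aemeasurable
  have hn := h.neg
  have e1 : seqLaw μ (Neg.neg ⁻¹' stays (Γ + δ) N) ≤
      ENNReal.ofReal ((1 + (1 + 2 * K) / v) * (Γ + δ + K) / √(N + 1)) := by
    rw [seqLaw_neg_preimage (measurableSet_stays _ _)]
    exact hn.seqLaw_stays_le N (by linarith)
  have e2 : seqLaw μ (Neg.neg ⁻¹' climbs Γ D) ≤ ENNReal.ofReal ((Γ + K) / (Γ + D)) := by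
    rw [seqLaw_neg_preimage (measurableSet_climbs _ _)]
    exact hn.seqLaw_climbs_le (by linarith) (by linarith)
  have e3 : seqLaw μ (Neg.neg ⁻¹' afterHit (δ - Γ) (climbs δ (Γ - δ))) ≤
      ENNReal.ofReal ((δ + K) / Γ) := by
    rw [seqLaw_neg_preimage (measurableSet_afterHit _ (measurableSet_climbs _ _))]
    refine (seqLaw_afterHit_le _ (measurableSet_climbs _ _)).trans ?_
    have := hn.seqLaw_climbs_le (a := δ) (e := Γ - δ) (by linarith) (by linarith)
    rwa [show δ + (Γ - δ) = Γ by ring] at this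
  have e4 : ∀ j : ℕ, seqLaw μ (afterHit (-((j : ℝ) * A))
      (dipClimb f (2 * A) (A + K) (Γ - 2 * A))) ≤
      ENNReal.ofReal ((1 + (1 + 2 * K) / v) * (2 * A + K) / √(f + 1) * ((3 * A + 2 * K) / Γ)) := by
    intro j
    refine (seqLaw_afterHit_le _ (measurableSet_dipClimb _ _ _ _)).trans ?_
    have := h.seqLaw_dipClimb_le f (a := 2 * A) (c := A + K) (e := Γ - 2 * A) (by linarith)
      (by linarith) (by linarith)
    rwa [← ENNReal.ofReal_mul (by positivity), show 2 * A + (Γ - 2 * A) = Γ by ring,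
      show 2 * A + (A + K) + K = 3 * A + 2 * K by ring] at this
  have e5 : seqLaw μ (⋃ j ∈ Finset.range (J + 1), afterHit (-((j : ℝ) * A))
      (dipClimb f (2 * A) (A + K) (Γ - 2 * A))) ≤ ENNReal.ofReal ((J + 1) *
        ((1 + (1 + 2 * K) / v) * (2 * A + K) / √(f + 1) * ((3 * A + 2 * K) / Γ))) := by
    refine (measure_biUnion_finset_le _ _).trans ((Finset.sum_le_sum fun j _ => e4 j).trans ?_)
    rw [Finset.sum_const, Finset.card_range, ← ENNReal.ofReal_nsmul, nsmul_eq_mul]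
    push_cast
    exact le_rfl
  refine (measure_union_le _ _).trans ?_
  rw [badBound, ENNReal.ofReal_add (by positivity) (by positivity),
    ENNReal.ofReal_add (by positivity) (by positivity),
    ENNReal.ofReal_add (by positivity) (by positivity)]
  exact add_le_add ((measure_union_le _ _).trans (add_le_add
    ((measure_union_le _ _).trans (add_le_add e1 e2)) e3)) e5

end

/-! ### Good environments -/

theorem stepsRight_potential (e : Env) (i : ℕ) :
    stepsRight (potential e) i = logRatio (e (i + 1)) := by
  have := potential_sub e (i + 1)
  rwa [add_sub_cancel_right] at this

theorem stepsLeft_potential (e : Env) (i : ℕ) :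
    stepsLeft (potential e) i = -logRatio (e (-i)) := by
  have := potential_sub e (-i)
  rw [show -(i : ℤ) - 1 = -((i : ℤ) + 1) by ring] at this
  simp only [stepsLeft, stepsRight]
  linarith

theorem abs_logRatio_le {η : ℝ} (hη : 0 < η) {a : Set.Ioo (0 : ℝ) 1}
    (ha : η ≤ (a : ℝ) ∧ (a : ℝ) ≤ 1 - η) : |logRatio a| ≤ Real.log ((1 - η) / η) := by
  have h0 : (0 : ℝ) < a := a.2.1
  have h1 : (0 : ℝ) < 1 - a := sub_pos.2 a.2.2
  rw [logRatio, abs_le]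
  constructor
  · rw [← Real.log_inv, inv_div]
    refine Real.log_le_log (div_pos hη (by linarith)) ?_
    rw [div_le_div_iff₀ (by linarith) h0]
    nlinarith
  · refine Real.log_le_log (div_pos h1 h0) ?_
    rw [div_le_div_iff₀ h0 hη]
    nlinarith

/-- Outside the rare events, the bottom of every basic valley is well separated from the rest of
the valley. -/
theorem conclusion_of_notMem_bad {e : Env} {η γ D A K : ℝ} {p n N J : ℕ} (hη : 0 < η)
    (hK : K = Real.log ((1 - η) / η)) (he : ∀ i, η ≤ (e i : ℝ) ∧ (e i : ℝ) ≤ 1 - η)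
    (hfη : 1 ≤ η * fScale p n) (hΓ : 0 < depthScale γ n) (hδ : 0 ≤ margin γ n) (hA : 0 < A)
    (hN : 2 * Real.log (2 * N) ≤ A) (hJ : D ≤ A * (J + 1))
    (hR : stepsRight (potential e) ∉
      badSide (depthScale γ n) (margin γ n) D A K N J (fScale p n))
    (hL : stepsLeft (potential e) ∉
      badSide (depthScale γ n) (margin γ n) D A K N J (fScale p n))
    (hT : ∀ j ≤ J, ¬ (stepsRight (potential e) ∈ tieSide (depthScale γ n) A j ∧
      stepsLeft (potential e) ∈ tieSide (depthScale γ n) A j)) :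
    (∃ v, IsBasicValley (potential e) (depthScale γ n) (margin γ n) v) ∧
      ∀ v, IsBasicValley (potential e) (depthScale γ n) (margin γ n) v →
        excursionLocalTime e v.bot (outside p n v)
            ≤ ENNReal.ofReal (2 / η * (1 / ((fScale p n : ℝ) + 1))) ∧
        ∀ k ∈ outside p n v,
          2 * Real.log |((k - v.bot : ℤ) : ℝ)| ≤ potential e k - potential e v.bot := by
  set S := potential e with hS
  have h0 : S 0 = 0 := potential_zero e
  have hsR : ∀ i, |stepsRight S i| ≤ K := fun i => by
    rw [hS, stepsRight_potential, hK]
    exact abs_logRatio_le hη (he _)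
  have hsL : ∀ i, |stepsLeft S i| ≤ K := fun i => by
    rw [hS, stepsLeft_potential, hK, abs_neg]
    exact abs_logRatio_le hη (he _)
  have hK0 : 0 ≤ K := (abs_nonneg _).trans (hsR 0)
  obtain ⟨hex, hall⟩ := exists_isBasicValley_and_bounds h0 hΓ hδ
    (isGoodSide_of_notMem hR) (isGoodSide_of_notMem hL)
  refine ⟨hex, fun v hv => ?_⟩
  obtain ⟨hvl, hvr, hD, hmin⟩ := hall v hv
  obtain ⟨l1, l2, l3, -⟩ := hv.left.1
  obtain ⟨r1, r2, r3, -⟩ := hv.right.1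
  have hmem : ∀ k ∈ outside p n v, k ∈ Set.Icc v.left v.right ∧ (fScale p n : ℤ) < |k - v.bot| := by
    rintro k ⟨h1, h2⟩
    refine ⟨h1, ?_⟩
    rw [lt_abs]
    rw [Set.mem_Icc] at h2
    omega
  have hlog : ∀ k ∈ outside p n v,
      2 * Real.log |((k - v.bot : ℤ) : ℝ)| ≤ S k - S v.bot := by
    intro k hk
    obtain ⟨hk1, hk2⟩ := hmem k hk
    by_contra hcon
    push Not at hcon
    have hpos : 0 < |k - v.bot| := by omega
    have hle : |k - v.bot| ≤ 2 * N := abs_le.2 ⟨by have := hk1.1; omega, by have := hk1.2; omega⟩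
    have hlogle : Real.log |((k - v.bot : ℤ) : ℝ)| ≤ Real.log (2 * N) := by
      rw [← Int.cast_abs]
      exact Real.log_le_log (by exact_mod_cast hpos) (by exact_mod_cast hle)
    have hSk : S k < S v.bot + A := by linarith
    have hbad : ∀ s : ℕ → ℝ, s ∉ badSide (depthScale γ n) (margin γ n) D A K N J (fScale p n) →
        ∀ j ≤ J, s ∉ afterHit (-((j : ℝ) * A)) (dipClimb (fScale p n) (2 * A) (A + K)
          (depthScale γ n - 2 * A)) := fun s hs j hj hmem => by
      refine hs (Or.inr ?_)
      simp only [Set.mem_iUnion]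
      exact ⟨j, Finset.mem_range.2 (by omega), hmem⟩
    rcases le_total 0 v.bot with hb | hb
    · obtain ⟨j, hj, h | h⟩ := exists_afterHit_of_low h0 hA hK0 hsR hsL hJ hb l1 r2.le hmin l3 r3 hD
        hk1 hk2 hSk
      · exact hbad _ hR j hj h
      · exact hT j hj h
    · obtain ⟨j, hj, h | h⟩ := exists_afterHit_of_low (S := fun k => S (-k)) (by simpa using h0) hA
        hK0 hsL (by rwa [stepsLeft_reflect]) hJ (l := -v.right) (m := -v.bot) (r := -v.left)
        (k := -k) (f := fScale p n) (Γ := depthScale γ n)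
        (by omega) (by omega) (by omega)
        (fun t ht => by
          rw [neg_neg]
          exact hmin (-t) ⟨by have := ht.2; omega, by have := ht.1; omega⟩)
        (by simpa only [neg_neg] using r3) (by simpa only [neg_neg] using l3)
        (by simpa only [neg_neg] using hD) ⟨by have := hk1.2; omega, by have := hk1.1; omega⟩
        (by rwa [← abs_neg, show -(-k - -v.bot) = k - v.bot by ring])
        (by simpa only [neg_neg] using hSk)
      · exact hbad _ hL j hj h
      · rw [stepsLeft_reflect] at h
        exact hT j hj ⟨h.2, h.1⟩
  exact ⟨excursionLocalTime_le_of_log_le hη he hfη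
    ((Set.finite_Icc v.left v.right).subset fun k hk => (hmem k hk).1)
    (fun k hk => (hmem k hk).2) hlog, hlog⟩

/-! ### The laws of the two sides of the potential -/

theorem measurable_logRatio : Measurable logRatio := by
  unfold logRatio
  fun_prop

theorem measurable_stepsRight {Ω : Type*} {m : MeasurableSpace Ω}
    {α : ℤ → Ω → Set.Ioo (0 : ℝ) 1} (h : ∀ i : ℤ, 0 < i → Measurable (α i)) :
    Measurable fun ω => stepsRight (potential fun i => α i ω) := by
  refine measurable_pi_lambda _ fun i => ?_
  simp only [stepsRight_potential]
  exact measurable_logRatio.comp (h _ (by omega))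

theorem measurable_stepsLeft {Ω : Type*} {m : MeasurableSpace Ω}
    {α : ℤ → Ω → Set.Ioo (0 : ℝ) 1} (h : ∀ i : ℤ, i ≤ 0 → Measurable (α i)) :
    Measurable fun ω => stepsLeft (potential fun i => α i ω) := by
  refine measurable_pi_lambda _ fun i => ?_
  simp only [stepsLeft_potential]
  exact (measurable_logRatio.comp (h _ (by omega))).neg

theorem map_steps_eq_seqLaw {Ω : Type*} [MeasurableSpace Ω] {Q : Measure Ω}
    {α : ℤ → Ω → Set.Ioo (0 : ℝ) 1} (hm : ∀ i, Measurable (α i)) (hi : iIndepFun α Q)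
    (hid : ∀ i, IdentDistrib (α i) (α 0) Q Q) {g : ℕ → ℤ} (hg : g.Injective)
    {φ : Set.Ioo (0 : ℝ) 1 → ℝ} (hφ : Measurable φ)
    [IsProbabilityMeasure (Q.map fun ω => φ (α 0 ω))] :
    Q.map (fun ω (i : ℕ) => φ (α (g i) ω)) = seqLaw (Q.map fun ω => φ (α 0 ω)) := by
  have h1 : iIndepFun (fun (i : ℕ) ω => φ (α (g i) ω)) Q :=
    (hi.precomp hg).comp (fun _ => φ) fun _ => hφ
  have h2 := h1.map_fun_eq_infinitePi_map fun i => hφ.comp (hm _)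
  refine h2.trans ?_
  rw [seqLaw]
  congr 1
  ext1 i
  exact ((hid (g i)).comp hφ).map_eq

theorem indepFun_steps {Ω : Type*} [MeasurableSpace Ω] {Q : Measure Ω}
    {α : ℤ → Ω → Set.Ioo (0 : ℝ) 1} (hm : ∀ i, Measurable (α i)) (hi : iIndepFun α Q) :
    IndepFun (fun ω => stepsRight (potential fun i => α i ω))
      (fun ω => stepsLeft (potential fun i => α i ω)) Q := by
  have h := indep_iSup_of_disjoint (m := fun i => MeasurableSpace.comap (α i) inferInstance)
    (fun i => (hm i).comap_le) hi.iIndep (S := Set.Ioi 0) (T := Set.Iic 0)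
    (Set.disjoint_left.2 fun x hx hy => not_lt.2 (Set.mem_Iic.1 hy) hx)
  have key : ∀ (T : Set ℤ) (i : ℤ), i ∈ T →
      Measurable[⨆ i ∈ T, MeasurableSpace.comap (α i) inferInstance] (α i) := fun T i hiT =>
    Measurable.mono (comap_measurable (α i))
      (le_iSup₂ (f := fun i (_ : i ∈ T) => MeasurableSpace.comap (α i) inferInstance) i hiT) le_rfl
  refine indep_of_indep_of_le_right (indep_of_indep_of_le_left h ?_) ?_
  · rw [← measurable_iff_comap_le]
    exact measurable_stepsRight fun i hi0 => key _ i hi0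
  · rw [← measurable_iff_comap_le]
    exact measurable_stepsLeft fun i hi0 => key _ i hi0

/-- The probability that the conclusion fails is at most the sum of the probabilities of the rare
events. -/
theorem measure_not_conclusion_le {Ω : Type*} [MeasurableSpace Ω] {Q : Measure Ω}
    [IsProbabilityMeasure Q] {α : ℤ → Ω → Set.Ioo (0 : ℝ) 1} (hm : ∀ i, Measurable (α i))
    (hi : iIndepFun α Q) (hid : ∀ i, IdentDistrib (α i) (α 0) Q Q)
    (hmean : ∫ ω, logRatio (α 0 ω) ∂Q = 0)
    (hvar : 0 < Var[fun ω => logRatio (α 0 ω); Q]) {η : ℝ} (hη : 0 < η) (hη2 : η < 1 / 2)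
    (hell : ∀ᵐ ω ∂Q, η ≤ (α 0 ω : ℝ) ∧ (α 0 ω : ℝ) ≤ 1 - η) :
    ∃ K c : ℝ, 0 < K ∧ 0 < c ∧ ∀ (γ D A : ℝ) (p n N J : ℕ), 1 ≤ η * fScale p n →
      0 < depthScale γ n → 0 ≤ margin γ n → 0 < A → 0 < D → 2 * Real.log (2 * N) ≤ A →
      D ≤ A * (J + 1) →
      Q {ω | ¬ ((∃ v, IsBasicValley (potential fun i => α i ω)
                  (depthScale γ n) (margin γ n) v) ∧
              ∀ v, IsBasicValley (potential fun i => α i ω)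
                  (depthScale γ n) (margin γ n) v →
                excursionLocalTime (fun i => α i ω) v.bot (outside p n v)
                    ≤ ENNReal.ofReal (2 / η * (1 / ((fScale p n : ℝ) + 1))) ∧
                ∀ k ∈ outside p n v,
                  2 * Real.log |((k - v.bot : ℤ) : ℝ)|
                    ≤ potential (fun i => α i ω) k - potential (fun i => α i ω) v.bot)}
        ≤ ENNReal.ofReal (2 * badBound c (depthScale γ n) (margin γ n) D A K N J (fScale p n) +
            (J + 1) * ((2 * A + K) / depthScale γ n) ^ 2) := by
  set K := Real.log ((1 - η) / η) with hK
  set μ := Q.map fun ω => logRatio (α 0 ω) with hμ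
  have hm0 : Measurable fun ω => logRatio (α 0 ω) := measurable_logRatio.comp (hm 0)
  have : IsProbabilityMeasure μ := Measure.isProbabilityMeasure_map hm0.aemeasurable
  have hlaw : IsStepLaw μ K Var[fun ω => logRatio (α 0 ω); Q] := by
    refine ⟨Real.log_pos ?_, ?_, ?_, hvar, ?_⟩
    · rw [one_lt_div hη]
      linarith
    · rw [hμ, ae_map_iff hm0.aemeasurable (measurableSet_le (by fun_prop) (by fun_prop))]
      filter_upwards [hell] with ω hω using abs_logRatio_le hη hω
    · rw [hμ, integral_map hm0.aemeasurable (by fun_prop)]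
      exact hmean
    · rw [hμ, integral_map hm0.aemeasurable (by fun_prop), variance_of_integral_eq_zero
        hm0.aemeasurable hmean]
  have hKpos := hlaw.bound_pos
  have hall : ∀ᵐ ω ∂Q, ∀ i, η ≤ (α i ω : ℝ) ∧ (α i ω : ℝ) ≤ 1 - η := by
    rw [ae_all_iff]
    intro i
    have hms : MeasurableSet {a : Set.Ioo (0 : ℝ) 1 | η ≤ (a : ℝ) ∧ (a : ℝ) ≤ 1 - η} := by
      rw [Set.ofPred_and]
      exact (measurableSet_le (by fun_prop) (by fun_prop)).inter
        (measurableSet_le (by fun_prop) (by fun_prop))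
    exact (hid i).symm.ae_snd hms hell
  set c := 1 + (1 + 2 * K) / Var[fun ω => logRatio (α 0 ω); Q] with hc
  refine ⟨K, c, hKpos, by positivity, fun γ D A p n N J hf hΓ hδ hA hD hN hJ => ?_⟩
  set R : Ω → ℕ → ℝ := fun ω => stepsRight (potential fun i => α i ω) with hRdef
  set L : Ω → ℕ → ℝ := fun ω => stepsLeft (potential fun i => α i ω) with hLdef
  set B := badSide (depthScale γ n) (margin γ n) D A K N J (fScale p n) with hB
  set b := badBound c (depthScale γ n) (margin γ n) D A K N J (fScale p n) with hb
  have hRm : Measurable R := measurable_stepsRight fun i _ => hm i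
  have hLm : Measurable L := measurable_stepsLeft fun i _ => hm i
  have hRlaw : Q.map R = seqLaw μ := by
    have := map_steps_eq_seqLaw (Q := Q) hm hi hid (g := fun i : ℕ => (i : ℤ) + 1)
      (fun a b h => by simpa using h) measurable_logRatio
    rw [← this]
    congr 1
    ext ω i
    exact stepsRight_potential _ i
  have : IsProbabilityMeasure (μ.map fun x => -x) :=
    Measure.isProbabilityMeasure_map measurable_neg.aemeasurable
  have hμ' : (μ.map fun x => -x) = Q.map fun ω => -logRatio (α 0 ω) := by
    rw [hμ, Measure.map_map measurable_neg hm0]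
    rfl
  have : IsProbabilityMeasure (Q.map fun ω => -logRatio (α 0 ω)) := hμ' ▸ inferInstance
  have hLlaw : Q.map L = seqLaw (μ.map fun x => -x) := by
    have := map_steps_eq_seqLaw (Q := Q) hm hi hid (g := fun i : ℕ => -(i : ℤ))
      (fun a b h => by simpa using h) measurable_logRatio.neg
    simp only [hμ']
    refine Eq.trans ?_ this
    congr 1
    ext ω i
    exact stepsLeft_potential _ i
  have hBm := measurableSet_badSide (depthScale γ n) (margin γ n) D A K N J (fScale p n)
  have hQR : Q (R ⁻¹' B) ≤ ENNReal.ofReal b := by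
    rw [← Measure.map_apply hRm hBm, hRlaw]
    exact hlaw.seqLaw_badSide_le hΓ hδ hD hA N J _
  have hQL : Q (L ⁻¹' B) ≤ ENNReal.ofReal b := by
    rw [← Measure.map_apply hLm hBm, hLlaw]
    exact hlaw.neg.seqLaw_badSide_le hΓ hδ hD hA N J _
  have hQT : ∀ j, Q (R ⁻¹' tieSide (depthScale γ n) A j ∩ L ⁻¹' tieSide (depthScale γ n) A j) ≤
      ENNReal.ofReal (((2 * A + K) / depthScale γ n) ^ 2) := by
    intro j
    have hTm := measurableSet_tieSide (depthScale γ n) A j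
    rw [(indepFun_steps hm hi).measure_inter_preimage_eq_mul _ _ hTm hTm, sq,
      ENNReal.ofReal_mul (by positivity)]
    refine mul_le_mul' ?_ ?_
    · rw [← Measure.map_apply hRm hTm, hRlaw]
      exact hlaw.seqLaw_tieSide_le hΓ hA j
    · rw [← Measure.map_apply hLm hTm, hLlaw]
      exact hlaw.neg.seqLaw_tieSide_le hΓ hA j
  have hb0 : 0 ≤ b := by
    rw [hb, badBound]
    positivity
  have hsub : ∀ᵐ ω ∂Q, ω ∈ {ω | ¬ ((∃ v, IsBasicValley (potential fun i => α i ω)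
                  (depthScale γ n) (margin γ n) v) ∧
              ∀ v, IsBasicValley (potential fun i => α i ω)
                  (depthScale γ n) (margin γ n) v →
                excursionLocalTime (fun i => α i ω) v.bot (outside p n v)
                    ≤ ENNReal.ofReal (2 / η * (1 / ((fScale p n : ℝ) + 1))) ∧
                ∀ k ∈ outside p n v,
                  2 * Real.log |((k - v.bot : ℤ) : ℝ)|
                    ≤ potential (fun i => α i ω) k - potential (fun i => α i ω) v.bot)} →
      ω ∈ (R ⁻¹' B ∪ L ⁻¹' B) ∪ ⋃ j ∈ Finset.range (J + 1),
        (R ⁻¹' tieSide (depthScale γ n) A j ∩ L ⁻¹' tieSide (depthScale γ n) A j) := by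
    filter_upwards [hall] with ω hω
    intro hbad
    by_contra hcon
    simp only [Set.mem_union, not_or, Set.mem_iUnion, not_exists] at hcon
    exact hbad (conclusion_of_notMem_bad hη hK hω hf hΓ hδ hA hN hJ hcon.1.1 hcon.1.2
      fun j hj h => hcon.2 j (Finset.mem_range.2 (by omega)) h)
  refine (measure_mono_ae hsub).trans ((measure_union_le _ _).trans ?_)
  rw [ENNReal.ofReal_add (by positivity) (by positivity), two_mul,
    ENNReal.ofReal_add hb0 hb0]
  refine add_le_add ((measure_union_le _ _).trans (add_le_add hQR hQL)) ?_
  refine (measure_biUnion_finset_le _ _).trans ((Finset.sum_le_sum fun j _ => hQT j).trans ?_)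
  rw [Finset.sum_const, Finset.card_range, ← ENNReal.ofReal_nsmul, nsmul_eq_mul]
  push_cast
  exact le_rfl

/-! ### Choice of the scales -/

theorem iterLog_succ (p n : ℕ) : iterLog (p + 1) n = Real.log (iterLog p n) := by
  simp [iterLog, Function.iterate_succ_apply']

theorem tendsto_iterLog (p : ℕ) : Tendsto (iterLog p) atTop atTop := by
  induction p with
  | zero => exact tendsto_natCast_atTop_atTop
  | succ p ih =>
    simp only [funext (iterLog_succ p)]
    exact Real.tendsto_log_atTop.comp ih

theorem eventually_iterLog_le {p : ℕ} (hp : 2 ≤ p) :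
    ∀ᶠ n in atTop, iterLog p n ≤ iterLog 2 n := by
  induction p, hp using Nat.le_induction with
  | base => exact .of_forall fun n => le_rfl
  | succ p _ ih =>
    filter_upwards [ih, (tendsto_iterLog p).eventually_ge_atTop 0] with n h1 h2
    rw [iterLog_succ]
    exact (Real.log_le_self h2).trans h1

theorem rate_eq (p n : ℕ) (h : 0 ≤ iterLog p n) :
    rate p n = √(iterLog (p + 1) n) / √(iterLog p n) := by
  rw [rate, Real.rpow_neg h, ← Real.sqrt_eq_rpow, ← Real.sqrt_eq_rpow, div_eq_mul_inv]

/-- With `l = log n`, `y = log_2 n`, `w = √(log_p n)`, `Γ` of the order of `l`, and the scales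
`N ≈ l ^ 4`, `A = 10 y`, `D = Γ w`, `J ≈ D / A`, the bound for the probability of the rare events is
of order `1 / w`. -/
theorem badBound_le {c K γ Γ l y w : ℝ} {N J f : ℕ} (hc : 0 < c) (hK : 0 < K) (hγ : 0 < γ)
    (hy : 10 ≤ y) (hKy : K ≤ y) (hγl : γ * y ≤ l) (hl : 10 * y ≤ l) (hΓl : l ≤ Γ)
    (hΓ2 : Γ ≤ 2 * l) (hw1 : 1 ≤ w) (hyw2 : y * w * w ≤ l) (hN : l ^ 4 ≤ N)
    (hf : (y * w ^ 2) ^ 2 ≤ f + 1) (hJ : J ≤ Γ * w / (10 * y)) :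
    2 * badBound c Γ (γ * y) (Γ * w) (10 * y) K N J f +
      (J + 1) * ((2 * (10 * y) + K) / Γ) ^ 2 ≤ (278 * c + 2 * γ + 95) / w := by
  have hy0 : 0 < y := by linarith
  have hl0 : 0 < l := by linarith
  have hΓ0 : 0 < Γ := by linarith
  have hw0 : 0 < w := by linarith
  have hyw : y * w ≤ l := le_trans (le_mul_of_one_le_right (by positivity) hw1) hyw2
  have hwl : w ≤ l := le_trans (le_mul_of_one_le_left hw0.le (by linarith)) hyw
  have t1 : c * (Γ + γ * y + K) / √(N + 1) ≤ 4 * c / w := by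
    have hs : l ^ 2 ≤ √((N : ℝ) + 1) := by
      refine Real.le_sqrt_of_sq_le ?_
      calc (l ^ 2) ^ 2 = l ^ 4 := by rw [← pow_mul]
        _ ≤ (N : ℝ) + 1 := by linarith
    have hnum : Γ + γ * y + K ≤ 4 * l := by linarith
    calc c * (Γ + γ * y + K) / √(N + 1) ≤ c * (4 * l) / l ^ 2 := by gcongr
      _ = 4 * c / l := by field_simp
      _ ≤ 4 * c / w := by gcongr
  have t2 : (Γ + K) / (Γ + Γ * w) ≤ 2 / w := by
    calc (Γ + K) / (Γ + Γ * w) ≤ (2 * Γ) / (Γ * w) := by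
          gcongr <;> linarith
      _ = 2 / w := by field_simp
  have t3 : (γ * y + K) / Γ ≤ (γ + 1) / w := by
    rw [div_le_div_iff₀ hΓ0 hw0]
    calc (γ * y + K) * w ≤ (γ * y + y) * w := by gcongr
      _ = (γ + 1) * (y * w) := by ring
      _ ≤ (γ + 1) * Γ := by gcongr; linarith
  have hJ1 : (J : ℝ) + 1 ≤ Γ * w / (5 * y) := by
    have : 1 ≤ Γ * w / (10 * y) := by
      rw [one_le_div (by positivity)]
      exact (hl.trans hΓl).trans (le_mul_of_one_le_right hΓ0.le hw1)
    calc (J : ℝ) + 1 ≤ Γ * w / (10 * y) + Γ * w / (10 * y) := add_le_add hJ this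
      _ = Γ * w / (5 * y) := by field_simp; norm_num
  have hA1 : 2 * (10 * y) + K ≤ 21 * y := by linarith
  have hA2 : 3 * (10 * y) + 2 * K ≤ 32 * y := by linarith
  have t4 : ((J : ℝ) + 1) * (c * (2 * (10 * y) + K) / √(f + 1) *
      ((3 * (10 * y) + 2 * K) / Γ)) ≤ 135 * c / w := by
    have hs : y * w ^ 2 ≤ √((f : ℝ) + 1) := Real.le_sqrt_of_sq_le hf
    calc ((J : ℝ) + 1) * (c * (2 * (10 * y) + K) / √(f + 1) * ((3 * (10 * y) + 2 * K) / Γ))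
        ≤ Γ * w / (5 * y) * (c * (21 * y) / (y * w ^ 2) * ((32 * y) / Γ)) := by gcongr
      _ = (672 / 5 * c) / w := by
          field_simp
          norm_num
      _ ≤ 135 * c / w := by gcongr; norm_num
  have t5 : ((J : ℝ) + 1) * ((2 * (10 * y) + K) / Γ) ^ 2 ≤ 89 / w := by
    calc ((J : ℝ) + 1) * ((2 * (10 * y) + K) / Γ) ^ 2
        ≤ Γ * w / (5 * y) * ((21 * y) / Γ) ^ 2 := by gcongr
      _ = (441 / 5) * (y * w) / Γ := by
          field_simp
          norm_num
      _ ≤ 89 / w := by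
          rw [div_le_div_iff₀ hΓ0 hw0]
          linarith
  have e : (278 * c + 2 * γ + 95) / w =
      2 * (4 * c / w + 2 / w + (γ + 1) / w + 135 * c / w) + 89 / w := by
    field_simp
    ring
  rw [e, badBound]
  linarith

theorem two_mul_log_two_mul_ceil_le {l : ℝ} (hl : 3 ≤ l) :
    2 * Real.log (2 * (⌈l ^ 4⌉₊ : ℝ)) ≤ 10 * Real.log l := by
  have h1 : (⌈l ^ 4⌉₊ : ℝ) < l ^ 4 + 1 := Nat.ceil_lt_add_one (by positivity)
  have h4 : (81 : ℝ) ≤ l ^ 4 := by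
    calc (81 : ℝ) = 3 ^ 4 := by norm_num
      _ ≤ l ^ 4 := by gcongr
  have h2 : 2 * (⌈l ^ 4⌉₊ : ℝ) ≤ l ^ 5 := by
    have : 3 * l ^ 4 ≤ l ^ 5 := by
      rw [pow_succ l 4]
      nlinarith
    linarith
  have h3 : 0 < 2 * (⌈l ^ 4⌉₊ : ℝ) := by
    have := Nat.le_ceil (l ^ 4)
    linarith
  have h5 := Real.log_le_log h3 h2
  rw [Real.log_pow] at h5
  push_cast at h5
  linarith

end Sinai

theorem mainTheorem6 :
    ∃ c : ℝ, 0 < c ∧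
      ∀ (Ω : Type*) [MeasurableSpace Ω] (Q : Measure Ω) [IsProbabilityMeasure Q]
        (α : ℤ → Ω → Set.Ioo (0 : ℝ) 1),
        (∀ i, Measurable (α i)) →
        iIndepFun α Q →
        (∀ i, IdentDistrib (α i) (α 0) Q Q) →
        (∫ ω, Sinai.logRatio (α 0 ω) ∂Q = 0) →
        0 < Var[fun ω => Sinai.logRatio (α 0 ω); Q] →
        ∀ η₀ : ℝ, 0 < η₀ → η₀ < 1 / 2 →
        (∀ᵐ ω ∂Q, η₀ ≤ (α 0 ω : ℝ) ∧ (α 0 ω : ℝ) ≤ 1 - η₀) →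
        ∀ γ : ℝ, 0 < γ →
        ∀ p : ℕ, 2 ≤ p →
        ∃ n₀ : ℕ, ∀ n : ℕ, n₀ < n →
          Q {ω | ¬ ((∃ v, Sinai.IsBasicValley (Sinai.potential fun i => α i ω)
                  (Sinai.depthScale γ n) (Sinai.margin γ n) v) ∧
              ∀ v, Sinai.IsBasicValley (Sinai.potential fun i => α i ω)
                  (Sinai.depthScale γ n) (Sinai.margin γ n) v →
                Sinai.excursionLocalTime (fun i => α i ω) v.bot (Sinai.outside p n v)
                    ≤ ENNReal.ofReal (2 / η₀ * (1 / ((Sinai.fScale p n : ℝ) + 1))) ∧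
                ∀ k ∈ Sinai.outside p n v,
                  2 * Real.log |((k - v.bot : ℤ) : ℝ)|
                    ≤ Sinai.potential (fun i => α i ω) k
                      - Sinai.potential (fun i => α i ω) v.bot)}
            ≤ ENNReal.ofReal (c * Sinai.rate p n) := by
  -- the rare events have probability `O(1 / √(log_p n))`, which is `o(R_p(n))`
  refine ⟨1, one_pos, ?_⟩
  intro Ω _ Q _ α hm hi hid hmean hvar η₀ hη hη2 hell γ hγ p hp
  obtain ⟨K, c, hK, hc, h⟩ :=
    Sinai.measure_not_conclusion_le hm hi hid hmean hvar hη hη2 hell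
  have hsq : ∀ᶠ n : ℕ in atTop, Sinai.iterLog 2 n ^ 2 ≤ Sinai.iterLog 1 n := by
    have h1 := (Real.isLittleO_pow_log_id_atTop (n := 2)).bound one_pos
    filter_upwards [(Sinai.tendsto_iterLog 1).eventually h1,
      (Sinai.tendsto_iterLog 1).eventually_ge_atTop 0] with n hn hn0
    rw [Sinai.iterLog_succ]
    simpa [abs_of_nonneg hn0] using hn
  have hev : ∀ᶠ n : ℕ in atTop, Q {ω | ¬ ((∃ v, Sinai.IsBasicValley (Sinai.potential fun i => α i ω)
                  (Sinai.depthScale γ n) (Sinai.margin γ n) v) ∧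
              ∀ v, Sinai.IsBasicValley (Sinai.potential fun i => α i ω)
                  (Sinai.depthScale γ n) (Sinai.margin γ n) v →
                Sinai.excursionLocalTime (fun i => α i ω) v.bot (Sinai.outside p n v)
                    ≤ ENNReal.ofReal (2 / η₀ * (1 / ((Sinai.fScale p n : ℝ) + 1))) ∧
                ∀ k ∈ Sinai.outside p n v,
                  2 * Real.log |((k - v.bot : ℤ) : ℝ)|
                    ≤ Sinai.potential (fun i => α i ω) k
                      - Sinai.potential (fun i => α i ω) v.bot)}
            ≤ ENNReal.ofReal (1 * Sinai.rate p n) := by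
    filter_upwards [hsq, Sinai.eventually_iterLog_le hp,
      (Sinai.tendsto_iterLog 1).eventually_ge_atTop 3,
      (Sinai.tendsto_iterLog 2).eventually_ge_atTop 10,
      (Sinai.tendsto_iterLog 2).eventually_ge_atTop K,
      (Sinai.tendsto_iterLog 2).eventually_ge_atTop γ,
      (Sinai.tendsto_iterLog 2).eventually_ge_atTop (1 / η₀ + 1),
      (Sinai.tendsto_iterLog p).eventually_ge_atTop 1,
      (Sinai.tendsto_iterLog (p + 1)).eventually_ge_atTop ((278 * c + 2 * γ + 95) ^ 2)]
      with n hyl hLy hl hy hKy hγy hηy hL hlast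
    set y := Sinai.iterLog 2 n with hydef
    set L := Sinai.iterLog p n with hLdef
    set l := Sinai.iterLog 1 n with hldef
    have hylog : y = Real.log l := Sinai.iterLog_succ 1 n
    have hΓ : Sinai.depthScale γ n = l + γ * y := rfl
    have hδ : Sinai.margin γ n = γ * y := rfl
    have hsL : 0 < √L := Real.sqrt_pos.2 (by linarith)
    have hD : 0 < (l + γ * y) * √L := by positivity
    have hyL : y ≤ y * L := le_mul_of_one_le_right (by linarith) hL
    have hfl : (y * L) ^ 2 < Sinai.fScale p n + 1 := Nat.lt_floor_add_one _
    have hfη : 1 ≤ η₀ * Sinai.fScale p n := by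
      have h1 : y ≤ (y * L) ^ 2 := by nlinarith
      have h2 : 1 / η₀ ≤ Sinai.fScale p n := by linarith
      rwa [div_le_iff₀ hη, mul_comm] at h2
    have hA : 0 < 10 * y := by linarith
    set J := ⌊(l + γ * y) * √L / (10 * y)⌋₊ with hJ
    have hJ1 : (J : ℝ) ≤ (l + γ * y) * √L / (10 * y) := Nat.floor_le (by positivity)
    have hJ2 : (l + γ * y) * √L ≤ 10 * y * (J + 1) := by
      have := Nat.lt_floor_add_one ((l + γ * y) * √L / (10 * y))
      rw [div_lt_iff₀ hA] at this
      linarith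
    refine (h γ ((l + γ * y) * √L) (10 * y) p n ⌈l ^ 4⌉₊ J hfη (by rw [hΓ]; positivity)
      (by rw [hδ]; positivity) hA hD
      (by rw [hylog]; exact Sinai.two_mul_log_two_mul_ceil_le hl) hJ2).trans ?_
    refine ENNReal.ofReal_le_ofReal ?_
    rw [hΓ, hδ, one_mul, Sinai.rate_eq p n (by linarith)]
    have hw2 : √L ^ 2 = L := Real.sq_sqrt (by linarith)
    have hγl : γ * y ≤ l := by nlinarith
    refine (Sinai.badBound_le hc hK hγ hy hKy hγl (by nlinarith) (by linarith [mul_pos hγ hA])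
      (by linarith) (Real.one_le_sqrt.2 hL) (by nlinarith) (Nat.le_ceil _)
      (by rw [hw2]; exact hfl.le) hJ1).trans ?_
    gcongr
    exact Real.le_sqrt_of_sq_le hlast
  obtain ⟨n₀, hn₀⟩ := eventually_atTop.1 hev
  exact ⟨n₀, fun n hn => hn₀ n hn.le⟩
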